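/- Setting. Let $A=\mathrm{diag}(\lambda_1,\lambda_2)$ with $\lambda_1,\lambda_2\in\mathbb C$, $|\lambda_1|\ge|\lambda_2|$, let $C\in\mathbb C^{m\times 2}$ with $(C,A)$ detectable (i.e. all eigenvalues of $A-LC$ have modulus $<1$ for some matrix $L$), and let $Q,\Sigma_0\in\mathbb C^{2\times2}$ and $R\in\mathbb C^{m\times m}$ be positive definite Hermitian matrices. Let $\gamma_0,\gamma_1,\dots$ be i.i.d. Bernoulli variables with $P(\gamma_k=1)=p$, and let $P_k$ be the one-step prediction error covariance of the Kalman filter with intermittent observations, $$P_{k+1}=AP_kA^H+Q-\gamma_k\,AP_kC^H(CP_kC^H+R)^{-1}CP_kA^H .$$ The critical value of the system is the number $p_c\in[0,1)$ such that $\mathbb E P_k$ with $P_0=\Sigma_0$ is unbounded for $0\le p\le p_c$, and $\mathbb E P_k$ is bounded (in the order of positive semidefinite matrices, uniformly in $k$) for $p_c<p\le1$ and every positive semidefinite $P_0$; at $p=0$ unboundedness is required only if $A$ has an eigenvalue of modulus $\ge 1$ (so that $p_c=0$ for stable $A$). Theorem. (i) If $|\lambda_1|>|\lambda_2|$ or $\operatorname{rank}C=2$,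 then $$p_c=\max\bigl(1-|\lambda_1|^{-2},\,0\bigr).$$ (ii) Otherwise, if $\varphi\in\mathbb R$ is any number with $\lambda_1=\lambda_2e^{j\varphi}$ (where $j^2=-1$), then $$p_c=\max\Bigl(1-|\lambda_1|^{-2/(1-D_M(\varphi/2\pi))},\,0\Bigr),$$ where $D_M(x)=0$ for irrational $x$ and $D_M(x)=1/q$ for $x=r/q$ in lowest terms, $q\ge1$. Here $0^{-s}$ for $s>0$ is read as $+\infty$, and so is $|\lambda_1|^{-2/0}$, which occurs only if $\lambda_1=\lambda_2$ and $|\lambda_1|<1$; thus $p_c=0$ in these cases. (iii) Call the system non-degenerate if for every set $I\subseteq\{1,2\}$ of indices whose $\lambda_i$ have equal modulus the columns $C_i$, $i\in I$, are linearly independent, and degenerate otherwise. Then in case (ii) the system is degenerate; and if $|\lambda_2|\ge1$, then the system is non-degenerate if and only if it is in case (i). -/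

import Mathlib

open MeasureTheory ProbabilityTheory Matrix
open scoped ComplexOrder

noncomputable section

/-- A square matrix is Schur stable if all its eigenvalues lie in the open unit disc. -/
def IsSchurStable {n : ℕ} (M : Matrix (Fin n) (Fin n) ℂ) : Prop :=
  ∀ μ ∈ spectrum ℂ M, ‖μ‖ < 1

/-- `(C, A)` is detectable: some output injection makes the observer error dynamics stable. -/
def IsDetectable {n m : ℕ} (A : Matrix (Fin n) (Fin n) ℂ) (C : Matrix (Fin m) (Fin n) ℂ) : Prop :=
  ∃ L : Matrix (Fin n) (Fin m) ℂ, IsSchurStable (A - L * C)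

/-- An equi-block of the system with state matrix `diag d`: an index set on which the
eigenvalues `d i` have the same modulus. -/
def IsEquiBlock {n : ℕ} (d : Fin n → ℂ) (I : Finset (Fin n)) : Prop :=
  ∀ i ∈ I, ∀ j ∈ I, ‖d i‖ = ‖d j‖

/-- The block of `C` formed by the columns with index in `I`. -/
def blockColumns {n m : ℕ} (C : Matrix (Fin m) (Fin n) ℂ) (I : Finset (Fin n)) :
    Matrix (Fin m) I ℂ :=
  C.submatrix id (fun i : I => (i : Fin n))

/-- The system `(diag d, C)` is non-degenerate: every equi-block is one step observable, that is,
the corresponding columns of `C` form a matrix of full column rank. -/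
def IsNondegenerate {n m : ℕ} (d : Fin n → ℂ) (C : Matrix (Fin m) (Fin n) ℂ) : Prop :=
  ∀ I : Finset (Fin n), IsEquiBlock d I → (blockColumns C I).rank = I.card

/-- The Kalman gain `K = P Cᴴ (C P Cᴴ + R)⁻¹`. -/
def kalmanGain {n m : ℕ} (C : Matrix (Fin m) (Fin n) ℂ) (R : Matrix (Fin m) (Fin m) ℂ)
    (P : Matrix (Fin n) (Fin n) ℂ) : Matrix (Fin n) (Fin m) ℂ :=
  P * Cᴴ * (C * P * Cᴴ + R)⁻¹

/-- The one-step prediction error covariance `P k` of the Kalman filter along the arrival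
sequence `γ` (`γ k = true` iff the measurement at time `k` is received), started at `P₀`:
the measurement update `P - γ K C P` followed by the time update `A (·) Aᴴ + Q`. -/
def errorCov {n m : ℕ} (A : Matrix (Fin n) (Fin n) ℂ) (C : Matrix (Fin m) (Fin n) ℂ)
    (Q : Matrix (Fin n) (Fin n) ℂ) (R : Matrix (Fin m) (Fin m) ℂ)
    (P₀ : Matrix (Fin n) (Fin n) ℂ) (γ : ℕ → Bool) : ℕ → Matrix (Fin n) (Fin n) ℂ
  | 0 => P₀
  | k + 1 =>
    let P := errorCov A C Q R P₀ γ k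
    A * (P - (if γ k then (1 : ℂ) else 0) • (kalmanGain C R P * C * P)) * Aᴴ + Q

/-- The law of an i.i.d. Bernoulli arrival sequence with arrival probability `p`. -/
def arrivalLaw (p : unitInterval) : Measure (ℕ → Bool) :=
  Measure.infinitePi (fun _ : ℕ => bernoulliMeasure true false p)

/-- The expected error covariance `E P k`, entry by entry. Every entry is a function of finitely
many arrivals, hence takes finitely many values and is integrable. -/
def expectedCov {n m : ℕ} (A : Matrix (Fin n) (Fin n) ℂ) (C : Matrix (Fin m) (Fin n) ℂ)
    (Q : Matrix (Fin n) (Fin n) ℂ) (R : Matrix (Fin m) (Fin m) ℂ)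
    (P₀ : Matrix (Fin n) (Fin n) ℂ) (p : unitInterval) (k : ℕ) : Matrix (Fin n) (Fin n) ℂ :=
  Matrix.of fun i j => ∫ γ, errorCov A C Q R P₀ γ k i j ∂(arrivalLaw p)

/-- A sequence of matrices is bounded if a single matrix dominates all of them in the order of
positive semidefinite matrices. -/
def IsLoewnerBounded {n : ℕ} (X : ℕ → Matrix (Fin n) (Fin n) ℂ) : Prop :=
  ∃ M : Matrix (Fin n) (Fin n) ℂ, ∀ k, (M - X k).PosSemidef

/-- `pc ∈ [0, 1)` is the critical value of the system with initial covariance `P₀`: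
for `p ≤ pc` the sequence `E P k` started at `P₀` is unbounded, and for `pc < p` the
sequence `E P k` is bounded for every positive semidefinite initial value.
At `p = 0` unboundedness is required only if `A` is not Schur stable (for Schur stable `A` the
sequence is bounded without any observation, and the critical value is `0`). -/
structure IsCriticalValue {n m : ℕ} (A : Matrix (Fin n) (Fin n) ℂ) (C : Matrix (Fin m) (Fin n) ℂ)
    (Q : Matrix (Fin n) (Fin n) ℂ) (R : Matrix (Fin m) (Fin m) ℂ)
    (P₀ : Matrix (Fin n) (Fin n) ℂ) (pc : ℝ) : Prop where
  nonneg : 0 ≤ pc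
  lt_one : pc < 1
  unbounded : ∀ p : unitInterval, (p : ℝ) ≤ pc → ((p : ℝ) = 0 → ¬ IsSchurStable A) →
    ¬ IsLoewnerBounded (expectedCov A C Q R P₀ p)
  bounded : ∀ p : unitInterval, pc < (p : ℝ) →
    ∀ P₁ : Matrix (Fin n) (Fin n) ℂ, P₁.PosSemidef → IsLoewnerBounded (expectedCov A C Q R P₁ p)

open Classical in
/-- The modified Dirichlet function: `0` at irrational numbers, `1 / q` at a rational number whose
denominator in lowest terms is `q ≥ 1`. -/
def modifiedDirichlet (x : ℝ) : ℝ :=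
  if h : ∃ r : ℚ, (r : ℝ) = x then 1 / (h.choose.den : ℝ) else 0

end

/-! ### Order estimates for a single step of the Riccati recursion. -/

section LoewnerOrder

open scoped MatrixOrder Matrix.Norms.L2Operator

variable {n m : ℕ}

/-! Everything balances the growth of the covariance during losses against the probability of those
losses. Without information the covariance grows by `‖l₁‖ ^ 2` per step, while `j` given losses have
probability `(1 - p) ^ j`. Since `Q` renews uncertainty in every direction, the expectation diverges
once `(1 - p) * ‖l₁‖ ^ 2 ≥ 1` (`not_isLoewnerBounded_of_one_le`). Conversely, if one arrival
determines the state up to a stable part, each arrival resets the covariance, and summing over the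
age of the last arrival gives a convergent series below that threshold
(`isLoewnerBounded_of_reset`). This settles rank two, and also `‖l₂‖ < 1 ≤ ‖l₁‖`.

In the remaining unstable cases some scalar output sees both modes. Two arrivals `d` steps apart
then determine the state, with uniform error bounds as long as `(l₂ / l₁) ^ d` stays away from `1`
(`exists_errorCov_le_of_pair`). If the resonant distances `d` are at least `N` apart, a window of
length `j` without a good pair has losses at all but about `j / N` of its times. A union bound makes
this exponentially unlikely, at rate `(1 - p) ^ (1 - 1 / N)`, and boundedness follows when `‖l₁‖ ^
2` times this rate is below `1` (`isLoewnerBounded_of_separated`). For a primitive `q`-th root of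
unity `l₂ / l₁` one takes `N = q`; if no positive power of `l₂ / l₁` equals `1`, any `N` is
available and the exponent tends to `1`.

The root of unity case is sharp: a null vector of `C` returns to its own line after `q` steps, so
arrivals at multiples of `q` are useless, and only `q - 1` losses are needed for a growth of `‖l₁‖ ^
(2 * q)` (`not_isLoewnerBounded_of_resonance`). -/

lemma mul_mul_conjTranspose_mono {k l : Type*} [Fintype k] [Fintype l] {X Y : Matrix k k ℂ}
    (h : X ≤ Y) (M : Matrix l k ℂ) : M * X * Mᴴ ≤ M * Y * Mᴴ := by
  rw [Matrix.le_iff] at h ⊢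
  have := h.mul_mul_conjTranspose_same M
  rwa [Matrix.mul_sub, Matrix.sub_mul] at this

lemma Matrix.IsHermitian.le_norm_smul_one {X : Matrix (Fin n) (Fin n) ℂ} (h : X.IsHermitian) :
    X ≤ ‖X‖ • (1 : Matrix (Fin n) (Fin n) ℂ) := by
  rw [← Algebra.algebraMap_eq_smul_one]
  exact IsSelfAdjoint.le_algebraMap_norm_self h

lemma mul_conjTranspose_le (M : Matrix (Fin n) (Fin n) ℂ) :
    M * Mᴴ ≤ ‖M‖ ^ 2 • (1 : Matrix (Fin n) (Fin n) ℂ) := by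
  rw [← Algebra.algebraMap_eq_smul_one]
  exact CStarAlgebra.mul_star_le_algebraMap_norm_sq

lemma smul_one_le_smul_one {a b : ℝ} (h : a ≤ b) :
    a • (1 : Matrix (Fin n) (Fin n) ℂ) ≤ b • 1 := by
  rw [Matrix.le_iff, ← sub_smul]
  exact Matrix.PosSemidef.one.smul (sub_nonneg.2 h)

lemma smul_mono_of_nonneg {a : ℝ} {X Y : Matrix (Fin n) (Fin n) ℂ} (ha : 0 ≤ a) (h : X ≤ Y) :
    a • X ≤ a • Y := by
  rw [Matrix.le_iff] at h ⊢
  rw [← smul_sub]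
  exact h.smul ha

lemma conj_le_of_le_smul_one {X : Matrix (Fin n) (Fin n) ℂ} {S b : ℝ} (hS : 0 ≤ S)
    (h : X ≤ S • 1) (M : Matrix (Fin n) (Fin n) ℂ) (hb : ‖M‖ ≤ b) :
    M * X * Mᴴ ≤ (b ^ 2 * S) • (1 : Matrix (Fin n) (Fin n) ℂ) := by
  refine (mul_mul_conjTranspose_mono h M).trans ?_
  rw [Matrix.mul_smul, Matrix.smul_mul, Matrix.mul_one]
  refine (smul_mono_of_nonneg hS (mul_conjTranspose_le M)).trans ?_
  rw [smul_smul, mul_comm]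
  exact smul_one_le_smul_one (mul_le_mul_of_nonneg_right (pow_le_pow_left₀ (norm_nonneg M) hb 2) hS)

/-- Process noise renews a fixed amount of uncertainty along any direction; in the divergence proofs
this amount restarts the growth after every arrival. -/
lemma Matrix.PosDef.exists_smul_vecMulVec_le {Q : Matrix (Fin n) (Fin n) ℂ} (hQ : Q.PosDef)
    (v : Fin n → ℂ) : ∃ s : ℝ, 0 < s ∧ s • vecMulVec v (star v) ≤ Q := by
  obtain ⟨r, hr, hrQ⟩ : ∃ r : ℝ, 0 < r ∧ algebraMap ℝ (Matrix (Fin n) (Fin n) ℂ) r ≤ Q := by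
    rcases isEmpty_or_nonempty (Fin n)
    · exact ⟨1, one_pos, le_of_eq (Subsingleton.elim _ _)⟩
    refine (CFC.exists_pos_algebraMap_le_iff hQ.isHermitian).2 fun x hx ↦ ?_
    exact (Matrix.isStrictlyPositive_iff_posDef.2 hQ).spectrum_pos hx
  set V := vecMulVec v (star v)
  have hV : V ≤ ‖V‖ • 1 := (posSemidef_vecMulVec_self_star v).isHermitian.le_norm_smul_one
  have hp : 0 < ‖V‖ + 1 := by positivity
  -- `r` bounds the spectrum of `Q` from below; the `+ 1` covers `v = 0`.
  refine ⟨r / (‖V‖ + 1), by positivity, ?_⟩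
  refine (smul_mono_of_nonneg (by positivity) hV).trans ?_
  rw [smul_smul]
  refine le_trans (smul_one_le_smul_one ?_) (hrQ.trans' (Algebra.algebraMap_eq_smul_one _).ge)
  rw [div_mul_eq_mul_div, div_le_iff₀ hp]
  nlinarith

variable {A : Matrix (Fin n) (Fin n) ℂ} {C : Matrix (Fin m) (Fin n) ℂ}
  {Q : Matrix (Fin n) (Fin n) ℂ} {R : Matrix (Fin m) (Fin m) ℂ} {P : Matrix (Fin n) (Fin n) ℂ}

/-- Completion of squares: the Joseph form of the measurement update with an arbitrary gain. -/
lemma joseph_form (hP : P.PosSemidef) (hR : R.PosDef) (L : Matrix (Fin n) (Fin m) ℂ) :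
    (1 - L * C) * P * (1 - L * C)ᴴ + L * R * Lᴴ =
      (P - kalmanGain C R P * C * P) +
        (L - kalmanGain C R P) * (C * P * Cᴴ + R) * (L - kalmanGain C R P)ᴴ := by
  have hS : (C * P * Cᴴ + R).PosDef := Matrix.PosDef.posSemidef_add (hP.mul_mul_conjTranspose_same C) hR
  have hu := (Matrix.isUnit_iff_isUnit_det _).1 hS.isUnit
  set S := C * P * Cᴴ + R with hSdef
  set K := kalmanGain C R P with hK
  -- The normal equations of the optimal gain; they absorb the cross terms of the square.
  have hKS : K * S = P * Cᴴ := by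
    rw [hK, kalmanGain, Matrix.mul_assoc, Matrix.nonsing_inv_mul _ hu, Matrix.mul_one]
  have hSK : S * Kᴴ = C * P := by
    have := congrArg conjTranspose hKS
    rwa [conjTranspose_mul, conjTranspose_mul, hS.isHermitian.eq, hP.isHermitian.eq,
      conjTranspose_conjTranspose] at this
  have hR' : R = S - C * P * Cᴴ := by rw [hSdef]; abel
  rw [Matrix.sub_mul L K S, hKS, conjTranspose_sub, conjTranspose_sub, conjTranspose_one,
    conjTranspose_mul, Matrix.sub_mul, Matrix.mul_sub (L * S - P * Cᴴ), Matrix.sub_mul (L * S) _ Kᴴ,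
    Matrix.mul_assoc L S Kᴴ, hSK]
  have hKPC : P * Cᴴ * Kᴴ = K * C * P := by
    rw [← hKS, Matrix.mul_assoc, hSK, Matrix.mul_assoc]
  rw [hKPC, hR']
  simp only [Matrix.sub_mul, Matrix.mul_sub, Matrix.one_mul, Matrix.mul_one, Matrix.mul_assoc]
  abel

/-- The Kalman gain minimises the Joseph form, so any convenient gain gives an upper bound.
Boundedness is proved by choosing gains by hand; `L = 0` says that a measurement never hurts. -/
lemma update_le (hP : P.PosSemidef) (hR : R.PosDef) (L : Matrix (Fin n) (Fin m) ℂ) :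
    P - kalmanGain C R P * C * P ≤ (1 - L * C) * P * (1 - L * C)ᴴ + L * R * Lᴴ := by
  rw [joseph_form hP hR, Matrix.le_iff, add_sub_cancel_left]
  exact (Matrix.PosSemidef.add (hP.mul_mul_conjTranspose_same C) hR.posSemidef).mul_mul_conjTranspose_same _

lemma update_eq (hP : P.PosSemidef) (hR : R.PosDef) :
    P - kalmanGain C R P * C * P = (1 - kalmanGain C R P * C) * P * (1 - kalmanGain C R P * C)ᴴ +
      kalmanGain C R P * R * (kalmanGain C R P)ᴴ := by
  rw [joseph_form hP hR, sub_self, Matrix.zero_mul, Matrix.zero_mul, add_zero]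

lemma update_posSemidef (hP : P.PosSemidef) (hR : R.PosDef) :
    (P - kalmanGain C R P * C * P).PosSemidef := by
  rw [update_eq hP hR]
  exact (hP.mul_mul_conjTranspose_same _).add (hR.posSemidef.mul_mul_conjTranspose_same _)

lemma update_le_self (hP : P.PosSemidef) (hR : R.PosDef) :
    P - kalmanGain C R P * C * P ≤ P := by
  simpa using update_le (C := C) hP hR 0

/-- A measurement does not reduce the uncertainty along an invisible direction. -/
lemma smul_vecMulVec_le_update (hP : P.PosSemidef) (hR : R.PosDef) {a : ℝ} {v : Fin n → ℂ}
    (hv : C *ᵥ v = 0) (h : a • vecMulVec v (star v) ≤ P) :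
    a • vecMulVec v (star v) ≤ P - kalmanGain C R P * C * P := by
  rw [update_eq hP hR]
  refine le_trans ?_ (le_add_of_nonneg_right
    (Matrix.nonneg_iff_posSemidef.2 (hR.posSemidef.mul_mul_conjTranspose_same _)))
  refine le_trans (le_of_eq ?_) (mul_mul_conjTranspose_mono h _)
  have : (1 - kalmanGain C R P * C) *ᵥ v = v := by
    rw [sub_mulVec, one_mulVec, ← mulVec_mulVec, hv, mulVec_zero, sub_zero]
  rw [Matrix.mul_smul, Matrix.smul_mul, mul_vecMulVec, this, vecMulVec_mul, ← star_mulVec, this]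

lemma vecMulVec_conj {a : ℝ} (M : Matrix (Fin n) (Fin n) ℂ) (v : Fin n → ℂ) :
    M * (a • vecMulVec v (star v)) * Mᴴ = a • vecMulVec (M *ᵥ v) (star (M *ᵥ v)) := by
  rw [Matrix.mul_smul, Matrix.smul_mul, mul_vecMulVec, vecMulVec_mul, ← star_mulVec]

variable {P₀ : Matrix (Fin n) (Fin n) ℂ} {γ : ℕ → Bool} {k : ℕ}

lemma errorCov_succ_of_true (h : γ k = true) :
    errorCov A C Q R P₀ γ (k + 1) = A * (errorCov A C Q R P₀ γ k -
      kalmanGain C R (errorCov A C Q R P₀ γ k) * C * errorCov A C Q R P₀ γ k) * Aᴴ + Q := by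
  simp [errorCov, h]

lemma errorCov_succ_of_false (h : γ k = false) :
    errorCov A C Q R P₀ γ (k + 1) = A * errorCov A C Q R P₀ γ k * Aᴴ + Q := by
  simp [errorCov, h]

lemma errorCov_posSemidef (hQ : Q.PosDef) (hR : R.PosDef) (hP₀ : P₀.PosSemidef) (γ : ℕ → Bool)
    (k : ℕ) : (errorCov A C Q R P₀ γ k).PosSemidef := by
  induction k with
  | zero => exact hP₀
  | succ k ih =>
    cases h : γ k
    · rw [errorCov_succ_of_false h]
      exact (ih.mul_mul_conjTranspose_same _).add hQ.posSemidef
    · rw [errorCov_succ_of_true h]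
      exact ((update_posSemidef ih hR).mul_mul_conjTranspose_same _).add hQ.posSemidef

lemma errorCov_succ_le (hQ : Q.PosDef) (hR : R.PosDef) (hP₀ : P₀.PosSemidef) (γ : ℕ → Bool)
    (k : ℕ) :
    errorCov A C Q R P₀ γ (k + 1) ≤ A * errorCov A C Q R P₀ γ k * Aᴴ + Q := by
  cases h : γ k
  · rw [errorCov_succ_of_false h]
  · rw [errorCov_succ_of_true h]
    gcongr
    exact mul_mul_conjTranspose_mono (update_le_self (errorCov_posSemidef hQ hR hP₀ γ k) hR) _

lemma errorCov_succ_le_of_true (hQ : Q.PosDef) (hR : R.PosDef) (hP₀ : P₀.PosSemidef)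
    (h : γ k = true) (L : Matrix (Fin n) (Fin m) ℂ) :
    errorCov A C Q R P₀ γ (k + 1) ≤
      A * ((1 - L * C) * errorCov A C Q R P₀ γ k * (1 - L * C)ᴴ + L * R * Lᴴ) * Aᴴ + Q := by
  rw [errorCov_succ_of_true h]
  gcongr
  exact mul_mul_conjTranspose_mono (update_le (errorCov_posSemidef hQ hR hP₀ γ k) hR L) _

lemma le_errorCov_succ (hQ : Q.PosDef) (hR : R.PosDef) (hP₀ : P₀.PosSemidef) :
    Q ≤ errorCov A C Q R P₀ γ (k + 1) := by
  have hP := errorCov_posSemidef (A := A) (C := C) hQ hR hP₀ γ k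
  cases h : γ k
  · rw [errorCov_succ_of_false h]
    exact le_add_of_nonneg_left (Matrix.nonneg_iff_posSemidef.2 (hP.mul_mul_conjTranspose_same _))
  · rw [errorCov_succ_of_true h]
    exact le_add_of_nonneg_left
      (Matrix.nonneg_iff_posSemidef.2 ((update_posSemidef hP hR).mul_mul_conjTranspose_same _))

lemma smul_vecMulVec_le_errorCov_succ_of_false {a : ℝ} {v : Fin n → ℂ} (hγ : γ k = false)
    (h : a • vecMulVec v (star v) ≤ errorCov A C Q R P₀ γ k) :
    a • vecMulVec (A *ᵥ v) (star (A *ᵥ v)) + Q ≤ errorCov A C Q R P₀ γ (k + 1) := by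
  rw [errorCov_succ_of_false hγ, ← vecMulVec_conj]
  gcongr
  exact mul_mul_conjTranspose_mono h _

lemma smul_vecMulVec_le_errorCov_succ (hQ : Q.PosDef) (hR : R.PosDef) (hP₀ : P₀.PosSemidef)
    {a : ℝ} {v : Fin n → ℂ} (hv : C *ᵥ v = 0)
    (h : a • vecMulVec v (star v) ≤ errorCov A C Q R P₀ γ k) :
    a • vecMulVec (A *ᵥ v) (star (A *ᵥ v)) + Q ≤ errorCov A C Q R P₀ γ (k + 1) := by
  cases hγ : γ k
  · exact smul_vecMulVec_le_errorCov_succ_of_false hγ h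
  · rw [errorCov_succ_of_true hγ, ← vecMulVec_conj]
    gcongr
    exact mul_mul_conjTranspose_mono
      (smul_vecMulVec_le_update (errorCov_posSemidef hQ hR hP₀ γ k) hR hv h) _

/-- Growth of the covariance over `j` steps. -/
lemma errorCov_add_le (hQ : Q.PosDef) (hR : R.PosDef) (hP₀ : P₀.PosSemidef) {α S : ℝ}
    (hα : 1 ≤ α) (hA : ‖A‖ ≤ α) (hS : 0 ≤ S) (h : errorCov A C Q R P₀ γ k ≤ S • 1) (j : ℕ) :
    errorCov A C Q R P₀ γ (k + j) ≤ ((α ^ 2) ^ j * (S + j * ‖Q‖)) • 1 := by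
  induction j with
  | zero => simpa using h
  | succ j ih =>
    refine (errorCov_succ_le hQ hR hP₀ γ (k + j)).trans ?_
    refine (add_le_add (conj_le_of_le_smul_one (by positivity) ih A hA)
      hQ.isHermitian.le_norm_smul_one).trans ?_
    rw [← add_smul]
    refine smul_one_le_smul_one ?_
    have h1 : 1 ≤ (α ^ 2) ^ (j + 1) := one_le_pow₀ (one_le_pow₀ hα)
    have h2 := mul_le_mul_of_nonneg_right h1 (norm_nonneg Q)
    rw [pow_succ (α ^ 2) j] at h2 ⊢
    push_cast
    linarith

end LoewnerOrder

/-! ### Expectations over the arrivals, and criteria for bounded and unbounded means. -/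

section Expectation

open scoped MatrixOrder

variable {n m : ℕ}

instance (p : unitInterval) : IsProbabilityMeasure (arrivalLaw p) := by
  unfold arrivalLaw; infer_instance

/-- The event that the measurements at the times in `s` are all lost. -/
def lossEvent (s : Finset ℕ) : Set (ℕ → Bool) := {γ | ∀ i ∈ s, γ i = false}

lemma arrivalLaw_lossEvent (p : unitInterval) (s : Finset ℕ) :
    (arrivalLaw p).real (lossEvent s) = (1 - (p : ℝ)) ^ s.card := by
  have h : lossEvent s = Set.pi (s : Set ℕ) (fun _ => {false}) := by
    ext γ; simp [lossEvent]
  rw [h, measureReal_def, arrivalLaw, Measure.infinitePi_pi _ (fun _ _ => .of_discrete),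
    ENNReal.toReal_prod]
  simp

lemma isClopen_lossEvent (s : Finset ℕ) : IsClopen (lossEvent s) := by
  have h : lossEvent s = Set.pi (s : Set ℕ) (fun _ => {false}) := by
    ext γ; simp [lossEvent]
  rw [h]
  exact ⟨isClosed_set_pi fun _ _ => isClosed_discrete _,
    isOpen_set_pi s.finite_toSet fun _ _ => isOpen_discrete _⟩

variable {A : Matrix (Fin n) (Fin n) ℂ} {C : Matrix (Fin m) (Fin n) ℂ}
  {Q : Matrix (Fin n) (Fin n) ℂ} {R : Matrix (Fin m) (Fin m) ℂ} {P₀ : Matrix (Fin n) (Fin n) ℂ}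

/-- Only the first `k` arrivals matter. On the compact space `ℕ → Bool` local constancy gives
integrability without separate measurability arguments. -/
lemma isLocallyConstant_errorCov (k : ℕ) :
    IsLocallyConstant (fun γ => errorCov A C Q R P₀ γ k) := by
  induction k with
  | zero => exact IsLocallyConstant.const _
  | succ k ih =>
    have hγ : IsLocallyConstant (fun γ : ℕ → Bool => γ k) :=
      (IsLocallyConstant.iff_continuous _).2 (continuous_apply k)
    exact IsLocallyConstant.comp₂ ih hγ
      (fun P b => A * (P - (if b then (1 : ℂ) else 0) • (kalmanGain C R P * C * P)) * Aᴴ + Q)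

lemma integrable_of_isLocallyConstant {E : Type*} [NormedAddCommGroup E]
    {f : (ℕ → Bool) → E} (hf : IsLocallyConstant f) (μ : Measure (ℕ → Bool))
    [IsFiniteMeasure μ] : Integrable f μ :=
  hf.continuous.integrable_of_hasCompactSupport (HasCompactSupport.of_compactSpace f)

lemma integrable_errorCov (p : unitInterval) (k : ℕ) (i j : Fin n) :
    Integrable (fun γ => errorCov A C Q R P₀ γ k i j) (arrivalLaw p) :=
  integrable_of_isLocallyConstant ((isLocallyConstant_errorCov k).comp fun X => X i j) _

lemma quadForm_expectedCov (p : unitInterval) (k : ℕ) (x : Fin n → ℂ) :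
    star x ⬝ᵥ expectedCov A C Q R P₀ p k *ᵥ x =
      ∫ γ, star x ⬝ᵥ errorCov A C Q R P₀ γ k *ᵥ x ∂(arrivalLaw p) := by
  simp only [dotProduct, mulVec, expectedCov, Matrix.of_apply]
  have hI (i j) : Integrable (fun γ => errorCov A C Q R P₀ γ k i j * x j) (arrivalLaw p) :=
    (integrable_errorCov p k i j).mul_const _
  rw [integral_finsetSum _ fun i _ => (integrable_finsetSum _ fun j _ => hI i j).const_mul _]
  refine Finset.sum_congr rfl fun i _ => ?_
  rw [integral_const_mul, integral_finsetSum _ fun j _ => hI i j]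
  congr 1
  exact Finset.sum_congr rfl fun j _ => (integral_mul_const _ _).symm

lemma integrable_quadForm (p : unitInterval) (k : ℕ) (x : Fin n → ℂ) :
    Integrable (fun γ => star x ⬝ᵥ errorCov A C Q R P₀ γ k *ᵥ x) (arrivalLaw p) :=
  integrable_of_isLocallyConstant
    ((isLocallyConstant_errorCov k).comp fun X => star x ⬝ᵥ X *ᵥ x) _

lemma isHermitian_expectedCov (hQ : Q.PosDef) (hR : R.PosDef) (hP₀ : P₀.PosSemidef)
    (p : unitInterval) (k : ℕ) : (expectedCov A C Q R P₀ p k).IsHermitian := by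
  ext i j
  simp only [expectedCov, conjTranspose_apply, Matrix.of_apply, RCLike.star_def]
  rw [← integral_conj]
  refine integral_congr_ae (.of_forall fun γ => ?_)
  exact (errorCov_posSemidef hQ hR hP₀ γ k).isHermitian.apply i j

/-- If every realisation satisfies one of finitely many bounds, each valid outside an event of
controlled probability, then the expected covariance is bounded. -/
lemma isLoewnerBounded_of_events (hQ : Q.PosDef) (hR : R.PosDef) (hP₀ : P₀.PosSemidef)
    (p : unitInterval) (E : ℕ → ℕ → Set (ℕ → Bool)) (a b : ℕ → ℝ)
    (hE : ∀ k j, MeasurableSet (E k j)) (ha : ∀ j, 0 ≤ a j)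
    (hb : ∀ k j, j ≤ k → (arrivalLaw p).real (E k j) ≤ b j)
    (hb₀ : ∀ j, 0 ≤ b j) (hab : Summable fun j => a j * b j)
    (h : ∀ k γ, ∃ j ≤ k, γ ∈ E k j ∧ errorCov A C Q R P₀ γ k ≤ a j • 1) :
    IsLoewnerBounded (expectedCov A C Q R P₀ p) := by
  set S := ∑' j, a j * b j
  refine ⟨S • 1, fun k => ?_⟩
  rw [posSemidef_iff_dotProduct_mulVec]
  refine ⟨?_, fun x => ?_⟩
  · refine Matrix.IsHermitian.sub ?_ (isHermitian_expectedCov hQ hR hP₀ p k)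
    simp [Matrix.IsHermitian, conjTranspose_smul]
  rw [sub_mulVec, dotProduct_sub, quadForm_expectedCov, sub_nonneg]
  -- Summing the bounds of all events that occur gives a scalar majorant, with no need for disjoint
  -- events; its mean is a partial sum of `∑ a j * b j`.
  set f : (ℕ → Bool) → ℝ := fun γ =>
    ∑ j ∈ Finset.range (k + 1), (E k j).indicator (fun _ => a j) γ with hf
  have hint (j) : Integrable ((E k j).indicator (fun _ => a j)) (arrivalLaw p) :=
    (integrable_const _).indicator (hE k j)
  have hfi : Integrable f (arrivalLaw p) := integrable_finsetSum _ fun j _ => hint j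
  have hfS : ∫ γ, f γ ∂(arrivalLaw p) ≤ S := by
    rw [integral_finsetSum _ fun j _ => hint j]
    refine le_trans (Finset.sum_le_sum fun j hj => ?_)
      (hab.sum_le_tsum (Finset.range (k + 1)) fun j _ => mul_nonneg (ha j) (hb₀ j))
    rw [integral_indicator_const _ (hE k j), smul_eq_mul, mul_comm]
    exact mul_le_mul_of_nonneg_left (hb k j (Nat.lt_succ_iff.1 (Finset.mem_range.1 hj))) (ha j)
  have hx : 0 ≤ star x ⬝ᵥ x := dotProduct_star_self_nonneg x
  calc ∫ γ, star x ⬝ᵥ errorCov A C Q R P₀ γ k *ᵥ x ∂(arrivalLaw p)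
      ≤ ∫ γ, (f γ : ℂ) * (star x ⬝ᵥ x) ∂(arrivalLaw p) := by
        refine integral_mono (integrable_quadForm p k x) (hfi.ofReal.mul_const _) fun γ => ?_
        obtain ⟨j, hj, hγ, hle⟩ := h k γ
        have h1 := (Matrix.le_iff.1 hle).dotProduct_mulVec_nonneg x
        rw [sub_mulVec, dotProduct_sub, sub_nonneg] at h1
        refine h1.trans ?_
        rw [smul_mulVec, one_mulVec, dotProduct_smul, Complex.real_smul]
        refine mul_le_mul_of_nonneg_right ?_ hx
        refine Complex.real_le_real.2 ?_
        have := Finset.single_le_sum (f := fun j => (E k j).indicator (fun _ => a j) γ)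
          (fun i _ => Set.indicator_nonneg (fun _ _ => ha i) γ)
          (Finset.mem_range.2 (Nat.lt_succ_of_le hj))
        simpa [Set.indicator_of_mem hγ] using this
    _ = ((∫ γ, f γ ∂(arrivalLaw p) : ℝ) : ℂ) * (star x ⬝ᵥ x) := by
        rw [integral_mul_const, integral_complex_ofReal]
    _ ≤ (S : ℂ) * (star x ⬝ᵥ x) :=
        mul_le_mul_of_nonneg_right (Complex.real_le_real.2 hfS) hx
    _ = star x ⬝ᵥ (S • (1 : Matrix (Fin n) (Fin n) ℂ)) *ᵥ x := by
        rw [smul_mulVec, one_mulVec, dotProduct_smul, Complex.real_smul]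

lemma isLoewnerBounded_of_forall_le (hQ : Q.PosDef) (hR : R.PosDef) (hP₀ : P₀.PosSemidef)
    (p : unitInterval) {S : ℝ} (hS : 0 ≤ S) (h : ∀ k γ, errorCov A C Q R P₀ γ k ≤ S • 1) :
    IsLoewnerBounded (expectedCov A C Q R P₀ p) := by
  refine isLoewnerBounded_of_events hQ hR hP₀ p (fun _ j => if j = 0 then Set.univ else ∅)
    (fun _ => S) (fun j => if j = 0 then 1 else 0) ?_ (fun _ => hS) ?_ ?_ ?_ ?_
  · intro _ j; split_ifs <;> simp
  · intro _ j _; split_ifs <;> simp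
  · intro j; split_ifs <;> simp
  · exact summable_of_ne_finset_zero (s := {0}) (by simp +contextual)
  · exact fun k γ => ⟨0, Nat.zero_le _, by simp, h k γ⟩

/-- Blockwise growth of the covariance along a direction `v`, in case all measurements at the
offsets `J` of a block of length `w` are lost, forces an unbounded expectation. -/
lemma not_isLoewnerBounded_of_block_growth (hQ : Q.PosDef) (hR : R.PosDef)
    (hP₀ : P₀.PosSemidef) (p : unitInterval) {w : ℕ} (J : Finset ℕ) (hJ : ∀ i ∈ J, i < w)
    (v : Fin n → ℂ) (hv : v ≠ 0) {s σ : ℝ} (hs : 0 < s) (hσ : 0 ≤ σ)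
    (hσp : 1 ≤ (1 - (p : ℝ)) ^ J.card * σ)
    (hreset : ∀ γ i, s • vecMulVec v (star v) ≤ errorCov A C Q R P₀ γ ((i + 1) * w))
    (hgrow : ∀ γ i a, 0 ≤ a → (∀ j ∈ J, γ (i * w + j) = false) →
      a • vecMulVec v (star v) ≤ errorCov A C Q R P₀ γ (i * w) →
      (s + σ * a) • vecMulVec v (star v) ≤ errorCov A C Q R P₀ γ ((i + 1) * w)) :
    ¬ IsLoewnerBounded (expectedCov A C Q R P₀ p) := by
  rintro ⟨M, hM⟩
  -- the lost times in the `j` blocks preceding block `i`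
  set T : ℕ → ℕ → Finset ℕ := fun i j =>
    (Finset.range j ×ˢ J).image fun q => (i - 1 - q.1) * w + q.2 with hT
  have hTcard (i j) (hj : j ≤ i) : (T i j).card = J.card * j := by
    rw [hT, Finset.card_image_of_injOn, Finset.card_product, Finset.card_range, mul_comm]
    rintro ⟨a, b⟩ hab ⟨c, d⟩ hcd heq
    simp only [Finset.coe_product, Set.mem_prod, Finset.mem_coe, Finset.mem_range] at hab hcd heq
    have hb := hJ b hab.2
    have hd := hJ d hcd.2
    have hw : 0 < w := by omega
    -- Offsets are less than `w`, so division by `w` recovers the block from the time.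
    have h1 : i - 1 - a = i - 1 - c := by
      have := congrArg (· / w) heq
      simpa [Nat.add_comm _ b, Nat.add_comm _ d, Nat.add_mul_div_right _ _ hw,
        Nat.div_eq_of_lt hb, Nat.div_eq_of_lt hd] using this
    rw [h1] at heq
    have h2 : a = c := by omega
    have h3 : b = d := by omega
    rw [h2, h3]
  -- The unrolled recursion `f (i + 1) = s + σ * f i` if the times `J` of block `i` are lost and `f
  -- (i + 1) = s` otherwise, with `f 0 = 0`.
  set f : ℕ → (ℕ → Bool) → ℝ := fun i γ =>
    ∑ j ∈ Finset.range i, (lossEvent (T i j)).indicator (fun _ => s * σ ^ j) γ with hf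
  have hf0 (i γ) : 0 ≤ f i γ :=
    Finset.sum_nonneg fun j _ => Set.indicator_nonneg (fun _ _ => by positivity) _
  have hTsucc (i j γ) : γ ∈ lossEvent (T (i + 1) (j + 1)) ↔
      (∀ b ∈ J, γ (i * w + b) = false) ∧ γ ∈ lossEvent (T i j) := by
    simp only [lossEvent, hT, Set.mem_ofPred_eq, Finset.mem_image, Finset.mem_product,
      Finset.mem_range, Prod.exists]
    constructor
    · intro h
      refine ⟨fun b hb => h _ ⟨0, b, ⟨by omega, hb⟩, by simp⟩, ?_⟩
      rintro _ ⟨a, b, ⟨ha, hb⟩, rfl⟩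
      refine h _ ⟨a + 1, b, ⟨by omega, hb⟩, ?_⟩
      congr 2
      omega
    · rintro ⟨h1, h2⟩ _ ⟨a, b, ⟨ha, hb⟩, rfl⟩
      rcases a with _ | a
      · simpa using h1 b hb
      · refine h2 _ ⟨a, b, ⟨by omega, hb⟩, ?_⟩
        congr 2
        omega
  have key (γ i) : f i γ • vecMulVec v (star v) ≤ errorCov A C Q R P₀ γ (i * w) := by
    induction i with
    | zero =>
      simp only [hf, Finset.range_zero, Finset.sum_empty, zero_smul, zero_mul]
      exact Matrix.nonneg_iff_posSemidef.2 (errorCov_posSemidef hQ hR hP₀ γ 0)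
    | succ i ih =>
      have h0 : (lossEvent (T (i + 1) 0)).indicator (fun _ => s * σ ^ 0) γ = s := by
        rw [Set.indicator_of_mem (by simp [lossEvent, hT]), pow_zero, mul_one]
      by_cases hγ : ∀ j ∈ J, γ (i * w + j) = false
      · have : f (i + 1) γ = s + σ * f i γ := by
          simp only [hf]
          rw [Finset.sum_range_succ', h0, Finset.mul_sum, add_comm]
          congr 1
          refine Finset.sum_congr rfl fun j _ => ?_
          by_cases h2 : γ ∈ lossEvent (T i j)
          · rw [Set.indicator_of_mem h2, Set.indicator_of_mem ((hTsucc i j γ).2 ⟨hγ, h2⟩)]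
            ring
          · rw [Set.indicator_of_notMem h2,
              Set.indicator_of_notMem fun h => h2 ((hTsucc i j γ).1 h).2, mul_zero]
        rw [this]
        exact hgrow γ i _ (hf0 i γ) hγ ih
      · have : f (i + 1) γ = s := by
          simp only [hf]
          rw [Finset.sum_range_succ', h0, Finset.sum_eq_zero, zero_add]
          intro j _
          rw [Set.indicator_of_notMem]
          rw [hTsucc]
          exact fun h => hγ h.1
        rw [this]
        exact hreset γ i
  have hint (i j) : Integrable ((lossEvent (T i j)).indicator (fun _ => s * σ ^ j))
      (arrivalLaw p) :=
    (integrable_const _).indicator (isClopen_lossEvent _).isOpen.measurableSet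
  have hfi (i) : Integrable (f i) (arrivalLaw p) := integrable_finsetSum _ fun j _ => hint i j
  -- The `j`-th term has mean `s * ((1 - p) ^ J.card * σ) ^ j ≥ s`, so the means grow at least
  -- linearly, even at the threshold itself.
  have hfint (i : ℕ) : s * i ≤ ∫ γ, f i γ ∂(arrivalLaw p) := by
    rw [integral_finsetSum _ fun j _ => hint i j]
    have : s * i = ∑ j ∈ Finset.range i, s := by simp [mul_comm]
    rw [this]
    refine Finset.sum_le_sum fun j hj => ?_
    rw [integral_indicator_const _ (isClopen_lossEvent _).isOpen.measurableSet, smul_eq_mul,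
      arrivalLaw_lossEvent, hTcard i j (Finset.mem_range.1 hj).le, pow_mul, mul_left_comm,
      ← mul_pow]
    exact le_mul_of_one_le_right hs.le (one_le_pow₀ hσp)
  have hx : 0 < star v ⬝ᵥ v := dotProduct_star_self_pos_iff.2 hv
  obtain ⟨r, hr⟩ : ∃ r : ℝ, star v ⬝ᵥ v = r := ⟨_, (Complex.eq_re_of_ofReal_le hx.le)⟩
  have hr0 : 0 < r := by rw [hr] at hx; exact_mod_cast hx
  have hbd (i : ℕ) : s * i * r ^ 2 ≤ (star v ⬝ᵥ M *ᵥ v).re := by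
    have h1 := (hM (i * w)).dotProduct_mulVec_nonneg v
    rw [sub_mulVec, dotProduct_sub, quadForm_expectedCov, sub_nonneg] at h1
    have h2 : ∫ γ, ((f i γ : ℝ) : ℂ) * (r ^ 2 : ℝ) ∂(arrivalLaw p) ≤
        ∫ γ, star v ⬝ᵥ errorCov A C Q R P₀ γ (i * w) *ᵥ v ∂(arrivalLaw p) := by
      refine integral_mono ((hfi i).ofReal.mul_const _) (integrable_quadForm p _ v) fun γ => ?_
      have h3 := (Matrix.le_iff.1 (key γ i)).dotProduct_mulVec_nonneg v
      rw [sub_mulVec, dotProduct_sub, sub_nonneg] at h3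
      refine le_trans (le_of_eq ?_) h3
      rw [smul_mulVec, vecMulVec_mulVec, dotProduct_smul, Complex.real_smul, op_smul_eq_smul,
        dotProduct_smul, hr]
      simp [pow_two]
    have h3 := h2.trans h1
    rw [integral_mul_const, integral_complex_ofReal] at h3
    have h4 := (Complex.le_def.1 h3).1
    refine le_trans ?_ h4
    rw [← Complex.ofReal_mul, Complex.ofReal_re]
    exact mul_le_mul_of_nonneg_right (hfint i) (by positivity)
  obtain ⟨i, hi⟩ := exists_nat_gt ((star v ⬝ᵥ M *ᵥ v).re / (s * r ^ 2))
  rw [div_lt_iff₀ (by positivity)] at hi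
  nlinarith [hbd i]

end Expectation

/-! ### Upper bounds: stable subspaces, resets by one measurement, noise accumulation. -/

section UpperBounds

open scoped MatrixOrder Matrix.Norms.L2Operator

variable {n m : ℕ} {A : Matrix (Fin n) (Fin n) ℂ} {C : Matrix (Fin m) (Fin n) ℂ}
  {Q : Matrix (Fin n) (Fin n) ℂ} {R : Matrix (Fin m) (Fin m) ℂ} {P₀ : Matrix (Fin n) (Fin n) ℂ}

/-- The covariance of the part of the state in a stable invariant subspace is bounded
irrespective of the arrivals. -/
lemma exists_forall_stable_part_le (hQ : Q.PosDef) (hR : R.PosDef) (hP₀ : P₀.PosSemidef)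
    {E : Matrix (Fin n) (Fin n) ℂ} (hEA : E * A = A * E) (hEE : E * E = E) (hAE : ‖A * E‖ < 1) :
    ∃ S : ℝ, 0 ≤ S ∧ ∀ k γ, E * errorCov A C Q R P₀ γ k * Eᴴ ≤ S • 1 := by
  set r := ‖A * E‖ with hr
  have hr0 : 0 ≤ r := norm_nonneg _
  have hr1 : 0 < 1 - r ^ 2 := by nlinarith
  have hQ' := (hQ.posSemidef.mul_mul_conjTranspose_same E).isHermitian.le_norm_smul_one
  have hP' := (hP₀.mul_mul_conjTranspose_same E).isHermitian.le_norm_smul_one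
  set q := ‖E * Q * Eᴴ‖ with hq
  set c := ‖E * P₀ * Eᴴ‖ with hc
  have hq0 : 0 ≤ q := norm_nonneg _
  have hc0 : 0 ≤ c := norm_nonneg _
  clear_value r q c
  have hd : 0 ≤ q / (1 - r ^ 2) := div_nonneg hq0 hr1.le
  have hS : 0 ≤ c + q / (1 - r ^ 2) := add_nonneg hc0 hd
  -- The initial value plus the fixed point of `x ↦ r ^ 2 * x + q`: this number is mapped to at most
  -- itself.
  refine ⟨c + q / (1 - r ^ 2), hS, fun k γ => ?_⟩
  induction k with
  | zero => exact hP'.trans (smul_one_le_smul_one (le_add_of_nonneg_right hd))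
  | succ k ih =>
    refine (mul_mul_conjTranspose_mono (errorCov_succ_le hQ hR hP₀ γ k) E).trans ?_
    -- As `E` is a projection commuting with `A`, the compressed covariance obeys its own recursion,
    -- with the contraction `A * E`.
    have h1 : E * (A * errorCov A C Q R P₀ γ k * Aᴴ + Q) * Eᴴ =
        (A * E) * (E * errorCov A C Q R P₀ γ k * Eᴴ) * (A * E)ᴴ + E * Q * Eᴴ := by
      have h2 : E * A = A * E * E := by rw [Matrix.mul_assoc, hEE, hEA]
      have h3 : Aᴴ * Eᴴ = Eᴴ * (A * E)ᴴ := by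
        rw [← conjTranspose_mul, ← conjTranspose_mul, ← h2]
      rw [Matrix.mul_add, Matrix.add_mul]
      congr 1
      calc E * (A * errorCov A C Q R P₀ γ k * Aᴴ) * Eᴴ
          = (E * A) * errorCov A C Q R P₀ γ k * (Aᴴ * Eᴴ) := by simp only [Matrix.mul_assoc]
        _ = _ := by rw [h2, h3]; simp only [Matrix.mul_assoc]
    rw [h1]
    refine (add_le_add (conj_le_of_le_smul_one hS ih (A * E) le_rfl) hQ').trans ?_
    rw [← add_smul]
    refine smul_one_le_smul_one ?_
    have h4 : q / (1 - r ^ 2) * (1 - r ^ 2) = q := div_mul_cancel₀ _ hr1.ne'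
    rw [← hr]
    nlinarith [mul_nonneg hc0 hr1.le]

/-- If the state matrix is a contraction then the error covariance is bounded. -/
lemma isLoewnerBounded_of_norm_lt_one (hQ : Q.PosDef) (hR : R.PosDef) (hP₀ : P₀.PosSemidef)
    (hA : ‖A‖ < 1) (p : unitInterval) : IsLoewnerBounded (expectedCov A C Q R P₀ p) := by
  obtain ⟨S, hS, h⟩ := exists_forall_stable_part_le (A := A) (C := C) (E := 1) hQ hR hP₀
    (by simp) (by simp) (by simpa using hA)
  exact isLoewnerBounded_of_forall_le hQ hR hP₀ p hS fun k γ => by simpa using h k γ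

/-- If one measurement determines the state up to a stable invariant subspace, then the expected
covariance is bounded as soon as losses are less frequent than the growth of `A` permits. -/
lemma isLoewnerBounded_of_reset (hQ : Q.PosDef) (hR : R.PosDef) (hP₀ : P₀.PosSemidef)
    {E : Matrix (Fin n) (Fin n) ℂ} (hEA : E * A = A * E) (hEE : E * E = E) (hAE : ‖A * E‖ < 1)
    {L : Matrix (Fin n) (Fin m) ℂ} (hL : 1 - L * C = (1 - L * C) * E) {α : ℝ} (hα : 1 ≤ α)
    (hA : ‖A‖ ≤ α) (p : unitInterval) (hp : α ^ 2 * (1 - (p : ℝ)) < 1) :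
    IsLoewnerBounded (expectedCov A C Q R P₀ p) := by
  obtain ⟨S, hS, hSle⟩ := exists_forall_stable_part_le (C := C) hQ hR hP₀ hEA hEE hAE
  set F := 1 - L * C with hF
  set z := ‖L * R * Lᴴ‖ with hz
  have hz0 : 0 ≤ z := norm_nonneg _
  have hFS : 0 ≤ ‖F‖ ^ 2 * S + z := add_nonneg (mul_nonneg (sq_nonneg _) hS) hz0
  obtain ⟨S', hS'⟩ : ∃ S', S' = α ^ 2 * (‖F‖ ^ 2 * S + z) + ‖Q‖ := ⟨_, rfl⟩
  have hS'0 : 0 ≤ S' := hS' ▸ add_nonneg (mul_nonneg (sq_nonneg _) hFS) (norm_nonneg _)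
  have hreset (k γ) (hγ : γ k = true) : errorCov A C Q R P₀ γ (k + 1) ≤ S' • 1 := by
    refine (errorCov_succ_le_of_true hQ hR hP₀ hγ L).trans ?_
    rw [hS', add_smul]
    refine add_le_add (conj_le_of_le_smul_one hFS ?_ A hA)
      hQ.isHermitian.le_norm_smul_one
    rw [add_smul]
    refine add_le_add ?_ (hR.posSemidef.mul_mul_conjTranspose_same L).isHermitian.le_norm_smul_one
    -- By `F = F * E` the updated covariance only involves the stable part, which is bounded
    -- whatever the past.
    have : F * errorCov A C Q R P₀ γ k * Fᴴ =
        F * (E * errorCov A C Q R P₀ γ k * Eᴴ) * Fᴴ := by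
      conv_lhs => rw [hL, conjTranspose_mul]
      simp only [Matrix.mul_assoc]
    rw [this]
    exact conj_le_of_le_smul_one hS (hSle k γ) F le_rfl
  have hp1 : 0 ≤ 1 - (p : ℝ) := sub_nonneg.2 p.2.2
  -- Event `j`: the last `j` measurements are lost. Growth starts from `S'` after the last arrival,
  -- or from `P₀` if there was none; the constant covers both.
  refine isLoewnerBounded_of_events hQ hR hP₀ p (fun k j => lossEvent (Finset.Ico (k - j) k))
    (fun j => (α ^ 2) ^ j * (S' + ‖P₀‖ + j * ‖Q‖)) (fun j => (1 - (p : ℝ)) ^ j)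
    (fun k j => (isClopen_lossEvent _).isOpen.measurableSet) (fun j => by positivity)
    (fun k j hj => ?_) (fun j => by positivity) ?_ fun k γ => ?_
  · rw [arrivalLaw_lossEvent, Nat.card_Ico, Nat.sub_sub_self hj]
  · have hx : ‖α ^ 2 * (1 - (p : ℝ))‖ < 1 := by
      rwa [Real.norm_of_nonneg (by positivity)]
    have h0 := (summable_geometric_of_norm_lt_one hx).mul_left (S' + ‖P₀‖)
    have h1 := (summable_pow_mul_geometric_of_norm_lt_one 1 hx).mul_left ‖Q‖
    refine (h0.add h1).congr fun j => ?_
    rw [mul_pow]; ring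
  · by_cases hex : ∃ t < k, γ t = true
    · let t := Nat.findGreatest (fun t => t < k ∧ γ t = true) k
      obtain ⟨t₀, ht₀, hγ₀⟩ := hex
      have ht : t < k ∧ γ t = true :=
        Nat.findGreatest_spec (P := fun t => t < k ∧ γ t = true) ht₀.le ⟨ht₀, hγ₀⟩
      refine ⟨k - (t + 1), Nat.sub_le _ _, ?_, ?_⟩
      · intro i hi
        rw [Finset.mem_Ico, Nat.sub_sub_self ht.1] at hi
        by_contra hne
        have h5 := Nat.le_findGreatest (P := fun t => t < k ∧ γ t = true) hi.2.le
          ⟨hi.2, by simpa using hne⟩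
        have h6 : i ≤ t := h5
        omega
      · have h := errorCov_add_le hQ hR hP₀ hα hA hS'0 (hreset t γ ht.2) (k - (t + 1))
        rw [Nat.add_sub_cancel' ht.1] at h
        refine h.trans (smul_one_le_smul_one ?_)
        have := norm_nonneg P₀
        gcongr
        linarith
    · push Not at hex
      refine ⟨k, le_rfl, fun i hi => ?_, ?_⟩
      · simpa using hex i (Finset.mem_Ico.1 hi).2
      · have h := errorCov_add_le (C := C) (γ := γ) (k := 0) hQ hR hP₀ hα hA (norm_nonneg P₀)
          hP₀.isHermitian.le_norm_smul_one k
        rw [zero_add] at h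
        refine h.trans (smul_one_le_smul_one ?_)
        gcongr
        linarith

/-- Accumulation of process noise after a measurement with gain `L`. -/
lemma errorCov_add_le_of_true (hQ : Q.PosDef) (hR : R.PosDef) (hP₀ : P₀.PosSemidef) {α : ℝ}
    (hα : 1 ≤ α) (hA : ‖A‖ ≤ α) {γ : ℕ → Bool} {s : ℕ} (hγ : γ s = true)
    (L : Matrix (Fin n) (Fin m) ℂ) (j : ℕ) :
    errorCov A C Q R P₀ γ (s + (j + 1)) ≤
      A ^ (j + 1) * ((1 - L * C) * errorCov A C Q R P₀ γ s * (1 - L * C)ᴴ) * (A ^ (j + 1))ᴴ +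
        ((α ^ 2) ^ (j + 1) * (‖L * R * Lᴴ‖ + (j + 1) * ‖Q‖)) • 1 := by
  set G := (1 - L * C) * errorCov A C Q R P₀ γ s * (1 - L * C)ᴴ
  have hz := (hR.posSemidef.mul_mul_conjTranspose_same L).isHermitian.le_norm_smul_one
  set z := ‖L * R * Lᴴ‖ with hz'
  have hz0 : 0 ≤ z := norm_nonneg _
  have hq0 : 0 ≤ ‖Q‖ := norm_nonneg _
  have hα2 : 1 ≤ α ^ 2 := one_le_pow₀ hα
  induction j with
  | zero =>
    refine (errorCov_succ_le_of_true hQ hR hP₀ hγ L).trans ?_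
    rw [Matrix.mul_add, Matrix.add_mul, add_assoc, zero_add, pow_one, pow_one]
    refine add_le_add le_rfl ?_
    refine (add_le_add (conj_le_of_le_smul_one hz0 hz A hA)
      hQ.isHermitian.le_norm_smul_one).trans ?_
    rw [← add_smul]
    refine smul_one_le_smul_one ?_
    push_cast
    nlinarith
  | succ j ih =>
    rw [← add_assoc s (j + 1) 1]
    refine (errorCov_succ_le hQ hR hP₀ γ _).trans ?_
    refine (add_le_add (mul_mul_conjTranspose_mono ih A) le_rfl).trans ?_
    rw [Matrix.mul_add, Matrix.add_mul, add_assoc]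
    refine add_le_add (le_of_eq ?_) ?_
    · rw [pow_succ' A (j + 1), conjTranspose_mul]
      simp only [Matrix.mul_assoc]
    · refine (add_le_add (conj_le_of_le_smul_one (by positivity) le_rfl A hA)
        hQ.isHermitian.le_norm_smul_one).trans ?_
      rw [← add_smul]
      refine smul_one_le_smul_one ?_
      have h1 : 1 ≤ (α ^ 2) ^ (j + 1 + 1) := one_le_pow₀ hα2
      have h2 := mul_le_mul_of_nonneg_right h1 hq0
      rw [pow_succ (α ^ 2) (j + 1)] at h2 ⊢
      push_cast
      linarith

end UpperBounds

/-! ### Two measurements at a nonresonant distance erase the past. -/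

section DeadBeat

open scoped MatrixOrder Matrix.Norms.L2Operator

variable {m : ℕ} {C : Matrix (Fin m) (Fin 2) ℂ} {Q : Matrix (Fin 2) (Fin 2) ℂ}
  {R : Matrix (Fin m) (Fin m) ℂ} {P₀ : Matrix (Fin 2) (Fin 2) ℂ} {l₁ l₂ : ℂ}

lemma norm_diagonal_two_le {a b : ℂ} {r : ℝ} (hr : 0 ≤ r) (ha : ‖a‖ ≤ r) (hb : ‖b‖ ≤ r) :
    ‖(diagonal ![a, b] : Matrix (Fin 2) (Fin 2) ℂ)‖ ≤ r := by
  rw [l2_opNorm_diagonal, pi_norm_le_iff_of_nonneg hr]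
  intro i
  fin_cases i <;> simpa

/-- Two measurements `d` steps apart cancel the initial error. -/
lemma deadBeat_identity {a b c : ℂ} (hc : c ≠ 0) (hab : a - b ≠ 0) :
    (1 - diagonal ![a / (a - b), -b / (a - b)] * !![1, c; c⁻¹, 1]) * diagonal ![a, b] *
      (1 - (2⁻¹ : ℂ) • !![1, c; c⁻¹, 1]) = 0 := by
  ext i j
  fin_cases i <;> fin_cases j <;>
    simp [Matrix.mul_apply, Fin.sum_univ_two, Matrix.one_apply, Matrix.diagonal_apply] <;>
    field_simp <;> ring

/-- After two measurements whose distance `d` is not resonant, the covariance is bounded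
independently of the covariance before them. -/
lemma exists_errorCov_le_of_pair (hQ : Q.PosDef) (hR : R.PosDef) (hP₀ : P₀.PosSemidef)
    (hl₁ : 1 ≤ ‖l₁‖) (hl : ‖l₂‖ ≤ ‖l₁‖) {w : Fin m → ℂ} (hw₀ : (w ᵥ* C) 0 ≠ 0)
    (hw₁ : (w ᵥ* C) 1 ≠ 0) {ε : ℝ} (hε : 0 < ε) :
    ∃ K : ℝ, 0 ≤ K ∧ ∀ γ s t k, s < t → t < k → γ s = true → γ t = true →
      ε ≤ ‖1 - (l₂ / l₁) ^ (t - s)‖ →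
      errorCov (diagonal ![l₁, l₂]) C Q R P₀ γ k ≤ ((‖l₁‖ ^ 2) ^ (k - s) * (K * (k - s : ℕ))) • 1 := by
  set α := ‖l₁‖ with hαdef
  have hl₁0 : l₁ ≠ 0 := by
    rintro rfl
    simp at hαdef
    linarith
  set A : Matrix (Fin 2) (Fin 2) ℂ := diagonal ![l₁, l₂] with hAdef
  have hA : ‖A‖ ≤ α := norm_diagonal_two_le (norm_nonneg _) le_rfl hl
  set c₀ := (w ᵥ* C) 0
  set c₁ := (w ᵥ* C) 1
  set L : Matrix (Fin 2) (Fin m) ℂ := vecMulVec ![c₀⁻¹, c₁⁻¹] w with hL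
  have hLC : L * C = !![1, c₁ / c₀; (c₁ / c₀)⁻¹, 1] := by
    rw [hL, vecMulVec_mul]
    ext i j
    fin_cases i <;> fin_cases j <;> simp [vecMulVec_apply, c₀, c₁, hw₀, hw₁, div_eq_mul_inv] <;>
      ring
  -- With `c = c₁ / c₀`, `(L * C) ^ 2 = 2 • (L * C)`, so `L' * C` is a projection and the first
  -- update leaves an error on the line of `(c, -1)`. After `d` steps this is `(l₁ ^ d * c, -l₂ ^
  -- d)`, a vector that `D * L * C` below fixes, so the second update cancels it.
  set L' : Matrix (Fin 2) (Fin m) ℂ := (2⁻¹ : ℂ) • L with hL'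
  obtain ⟨z₀, hz₀⟩ : ∃ z, z = ‖L' * R * L'ᴴ‖ := ⟨_, rfl⟩
  obtain ⟨z₁, hz₁⟩ : ∃ z, z = ‖L * R * Lᴴ‖ := ⟨_, rfl⟩
  obtain ⟨q, hq⟩ : ∃ z, z = ‖Q‖ := ⟨_, rfl⟩
  obtain ⟨κ, hκ⟩ : ∃ z, z = 1 + ε⁻¹ * ‖L * C‖ := ⟨_, rfl⟩
  have hz₀0 : 0 ≤ z₀ := hz₀ ▸ norm_nonneg _
  have hz₁0 : 0 ≤ z₁ := hz₁ ▸ norm_nonneg _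
  have hq0 : 0 ≤ q := hq ▸ norm_nonneg _
  have hα2 : 1 ≤ α ^ 2 := one_le_pow₀ hl₁
  have hε' : 0 ≤ ε⁻¹ := inv_nonneg.2 hε.le
  -- The noise of the first measurement and of the gap passes the second update, amplified by at
  -- most `κ ^ 2`; then the noise of the second measurement and fresh process noise are added. The
  -- covariance at time `s` does not enter.
  obtain ⟨K, hK⟩ : ∃ K, K = κ ^ 2 * (z₀ + q) + ε⁻¹ ^ 2 * z₁ + q := ⟨_, rfl⟩
  have hK1 : 0 ≤ κ ^ 2 * (z₀ + q) := mul_nonneg (sq_nonneg _) (add_nonneg hz₀0 hq0)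
  have hK2 : 0 ≤ ε⁻¹ ^ 2 * z₁ := mul_nonneg (sq_nonneg _) hz₁0
  refine ⟨K, by rw [hK]; linarith, fun γ s t k hst htk hγs hγt hres => ?_⟩
  obtain ⟨j, rfl⟩ : ∃ j, t = s + (j + 1) := ⟨t - s - 1, by omega⟩
  obtain ⟨i, rfl⟩ : ∃ i, k = s + (j + 1) + 1 + i := ⟨k - (s + (j + 1) + 1), by omega⟩
  have hd : s + (j + 1) - s = j + 1 := by omega
  rw [hd] at hres
  set d := j + 1 with hdj
  have hkd : s + d + 1 + i - s = d + 1 + i := by omega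
  -- the gain cancelling the error left by the first measurement
  have hl₁d : l₁ ^ d ≠ 0 := pow_ne_zero _ hl₁0
  have hz : 1 - (l₂ / l₁) ^ d = (l₁ ^ d - l₂ ^ d) / l₁ ^ d := by
    rw [div_pow, sub_div, div_self hl₁d]
  have hne : l₁ ^ d - l₂ ^ d ≠ 0 := by
    intro h
    rw [hz, h, zero_div, norm_zero] at hres
    linarith
  set D : Matrix (Fin 2) (Fin 2) ℂ :=
    diagonal ![l₁ ^ d / (l₁ ^ d - l₂ ^ d), -l₂ ^ d / (l₁ ^ d - l₂ ^ d)] with hD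
  -- This entry is the inverse of `1 - (l₂ / l₁) ^ d`; here nonresonance becomes a uniform gain
  -- bound.
  have hD₁ : ‖l₁ ^ d / (l₁ ^ d - l₂ ^ d)‖ ≤ ε⁻¹ := by
    rw [hz, norm_div] at hres
    rw [norm_div, ← inv_div]
    exact inv_anti₀ hε hres
  have hD₂ : ‖-l₂ ^ d / (l₁ ^ d - l₂ ^ d)‖ ≤ ε⁻¹ := by
    refine le_trans ?_ hD₁
    rw [norm_div, norm_div, norm_neg, norm_pow, norm_pow]
    gcongr
  have hDε : ‖D‖ ≤ ε⁻¹ := norm_diagonal_two_le hε' hD₁ hD₂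
  have hF : ‖1 - D * L * C‖ ≤ κ := by
    rw [Matrix.mul_assoc, hκ]
    refine (norm_sub_le _ _).trans (add_le_add ?_ ?_)
    · exact norm_one.le
    · exact (norm_mul_le _ _).trans (mul_le_mul_of_nonneg_right hDε (norm_nonneg _))
  have hAd : A ^ d = diagonal ![l₁ ^ d, l₂ ^ d] := by
    rw [hAdef, diagonal_pow]
    congr 1
    ext i
    fin_cases i <;> simp
  have hdead : (1 - D * L * C) * A ^ d * (1 - L' * C) = 0 := by
    rw [hAd, hL', Matrix.smul_mul, Matrix.mul_assoc D L C, hLC]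
    exact deadBeat_identity (div_ne_zero hw₁ hw₀) hne
  clear_value D
  set P := errorCov A C Q R P₀ γ s with hP
  have hpre := errorCov_add_le_of_true (C := C) hQ hR hP₀ hl₁ hA hγs L' j
  rw [← hP, ← hz₀, ← hq, ← hdj] at hpre
  obtain ⟨τ, hτ⟩ : ∃ τ, τ = (α ^ 2) ^ d * (z₀ + (j + 1) * q) := ⟨_, rfl⟩
  have hτ0 : 0 ≤ τ := by rw [hτ]; positivity
  rw [← hτ] at hpre
  have hpost : errorCov A C Q R P₀ γ (s + d + 1) ≤
      ((α ^ 2) ^ (d + 1) * (K * (d + 1 : ℕ))) • 1 := by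
    refine (errorCov_succ_le_of_true hQ hR hP₀ hγt (D * L)).trans ?_
    have h1 : (1 - D * L * C) * errorCov A C Q R P₀ γ (s + d) * (1 - D * L * C)ᴴ ≤
        (κ ^ 2 * τ) • (1 : Matrix (Fin 2) (Fin 2) ℂ) := by
      refine (mul_mul_conjTranspose_mono hpre _).trans ?_
      have h0 : (1 - D * L * C) * (A ^ d * ((1 - L' * C) * P * (1 - L' * C)ᴴ) * (A ^ d)ᴴ) *
          (1 - D * L * C)ᴴ = 0 := by
        have : (1 - D * L * C) * (A ^ d * ((1 - L' * C) * P * (1 - L' * C)ᴴ) * (A ^ d)ᴴ) *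
          (1 - D * L * C)ᴴ = ((1 - D * L * C) * A ^ d * (1 - L' * C)) * P * (1 - L' * C)ᴴ *
            (A ^ d)ᴴ * (1 - D * L * C)ᴴ := by simp only [Matrix.mul_assoc]
        rw [this, hdead]
        simp only [Matrix.zero_mul]
      rw [Matrix.mul_add, Matrix.add_mul, h0, zero_add]
      exact conj_le_of_le_smul_one hτ0 le_rfl _ hF
    have h2 : D * L * R * (D * L)ᴴ ≤ (ε⁻¹ ^ 2 * z₁) • (1 : Matrix (Fin 2) (Fin 2) ℂ) := by
      have : D * L * R * (D * L)ᴴ = D * (L * R * Lᴴ) * Dᴴ := by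
        rw [conjTranspose_mul]
        simp only [Matrix.mul_assoc]
      rw [this]
      refine conj_le_of_le_smul_one hz₁0 ?_ D hDε
      rw [hz₁]
      exact (hR.posSemidef.mul_mul_conjTranspose_same L).isHermitian.le_norm_smul_one
    have h3 := add_le_add h1 h2
    rw [← add_smul] at h3
    have h4 : 0 ≤ κ ^ 2 * τ := mul_nonneg (sq_nonneg _) hτ0
    refine (add_le_add (conj_le_of_le_smul_one (add_nonneg h4 hK2) h3 A hA)
      hQ.isHermitian.le_norm_smul_one).trans ?_
    rw [← add_smul, ← hq]
    refine smul_one_le_smul_one ?_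
    have h5 : 1 ≤ (α ^ 2) ^ d := one_le_pow₀ hα2
    have h6 : κ ^ 2 * τ + ε⁻¹ ^ 2 * z₁ + q ≤ (α ^ 2) ^ d * (K * (d + 1 : ℕ)) := by
      have h7 : κ ^ 2 * τ = (α ^ 2) ^ d * (κ ^ 2 * (z₀ + (j + 1) * q)) := by rw [hτ]; ring
      have h8 : ε⁻¹ ^ 2 * z₁ + q ≤ (α ^ 2) ^ d * (ε⁻¹ ^ 2 * z₁ + q) :=
        le_mul_of_one_le_left (add_nonneg hK2 hq0) h5
      have h9 : κ ^ 2 * (z₀ + (j + 1) * q) + (ε⁻¹ ^ 2 * z₁ + q) ≤ K * (d + 1 : ℕ) := by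
        rw [hK, hdj]
        push_cast
        have h10 : 0 ≤ κ ^ 2 * z₀ := mul_nonneg (sq_nonneg _) hz₀0
        have h11 : 0 ≤ κ ^ 2 * q := mul_nonneg (sq_nonneg _) hq0
        have hj : (0 : ℝ) ≤ j := Nat.cast_nonneg j
        nlinarith [mul_nonneg h10 hj, mul_nonneg h11 hj, mul_nonneg hK2 hj, mul_nonneg hq0 hj]
      have h12 := mul_le_mul_of_nonneg_left h9 (zero_le_one.trans h5)
      linarith
    have h13 := mul_le_mul_of_nonneg_left h6 (zero_le_one.trans hα2)
    have h14 : q ≤ α ^ 2 * q := le_mul_of_one_le_left hq0 hα2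
    rw [pow_succ' (α ^ 2) d, mul_assoc]
    linarith
  have hKn : 0 ≤ K := by rw [hK]; linarith
  have hfin := errorCov_add_le hQ hR hP₀ hl₁ hA
    (by positivity) hpost i
  rw [hkd]
  refine hfin.trans (smul_one_le_smul_one ?_)
  rw [pow_add (α ^ 2) (d + 1) i, mul_comm ((α ^ 2) ^ (d + 1)) ((α ^ 2) ^ i), mul_assoc]
  refine mul_le_mul_of_nonneg_left ?_ (by positivity)
  rw [← hq]
  have h14 : q ≤ (α ^ 2) ^ (d + 1) * K := by
    have : K ≤ (α ^ 2) ^ (d + 1) * K := le_mul_of_one_le_left hKn (one_le_pow₀ hα2)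
    rw [hK] at this ⊢
    linarith
  have h15 := mul_le_mul_of_nonneg_left h14 (Nat.cast_nonneg (α := ℝ) i)
  push_cast
  linarith

end DeadBeat

/-! ### Counting resonant distances, and the probability of windows without a good pair. -/

section ResonantGaps

/-- The times `i` in the window `[a, k)` except those at a distance in `B` after `s`. -/
def nonresonantTimes (B : ℕ → Prop) [DecidablePred B] (a k s : ℕ) : Finset ℕ :=
  (Finset.Ico a k).filter fun i => ¬ (s ≤ i ∧ B (i - s))

/-- Division by `N` is injective on such a set, since each interval of length `N` holds at most one
element. -/
lemma card_le_of_separated {N : ℕ} (hN : 0 < N) (s : Finset ℕ)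
    (hs : ∀ d ∈ s, ∀ d' ∈ s, d < d' → d + N ≤ d') {j : ℕ} (hj : ∀ d ∈ s, d < j) :
    s.card ≤ j / N + 1 := by
  rw [← Finset.card_range (j / N + 1)]
  refine Finset.card_le_card_of_injOn (fun d => d / N) (fun d hd => ?_) fun d hd d' hd' h => ?_
  · have := Nat.div_le_div_right (c := N) (hj d hd).le
    simp only [Finset.coe_range, Set.mem_Iio]
    omega
  · dsimp only at h
    have h1 := Nat.div_add_mod d N
    have h2 := Nat.div_add_mod d' N
    have h3 := Nat.mod_lt d hN
    have h4 := Nat.mod_lt d' hN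
    rw [h] at h1
    rcases lt_trichotomy d d' with hlt | heq | hlt
    · have := hs d hd d' hd' hlt
      omega
    · exact heq
    · have := hs d' hd' d hd hlt
      omega

lemma le_card_nonresonantTimes {B : ℕ → Prop} [DecidablePred B] {N : ℕ} (hN : 0 < N)
    (hB : ∀ d d', B d → B d' → d < d' → d + N ≤ d') {j k s : ℕ} (hj : j ≤ k) (hs : k - j ≤ s) :
    j ≤ (nonresonantTimes B (k - j) k s).card + (j / N + 1) := by
  have h1 := Finset.card_filter_add_card_filter_not (s := Finset.Ico (k - j) k)
    (fun i => ¬ (s ≤ i ∧ B (i - s)))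
  rw [Nat.card_Ico, Nat.sub_sub_self hj] at h1
  have h2 : ((Finset.Ico (k - j) k).filter fun i => ¬ ¬ (s ≤ i ∧ B (i - s))).card ≤ j / N + 1 := by
    rw [← Finset.card_image_of_injOn (f := fun i => i - s)]
    · refine card_le_of_separated hN _ (fun d hd d' hd' hdd => ?_) fun d hd => ?_
      · simp only [Finset.mem_image, Finset.mem_filter, not_not] at hd hd'
        obtain ⟨i, ⟨-, -, hi⟩, rfl⟩ := hd
        obtain ⟨i', ⟨-, -, hi'⟩, rfl⟩ := hd'
        exact hB _ _ hi hi' hdd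
      · simp only [Finset.mem_image, Finset.mem_filter, not_not, Finset.mem_Ico] at hd
        obtain ⟨i, ⟨hik, hsi, -⟩, rfl⟩ := hd
        omega
    · intro i hi i' hi' h
      simp only [Finset.coe_filter, not_not, Set.mem_ofPred_eq] at hi hi'
      dsimp only at h
      omega
  unfold nonresonantTimes
  omega

/-- A union bound over the `j + 1` values of `s`: each forces at least `j - j / N - 1` losses, the
`- 1` producing `η⁻¹`. Using `η` in place of `1 - p` keeps the base positive when `p = 1`. -/
lemma arrivalLaw_iUnion_lossEvent_le {B : ℕ → Prop} [DecidablePred B] {N : ℕ} (hN : 0 < N)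
    (hB : ∀ d d', B d → B d' → d < d' → d + N ≤ d') (p : unitInterval) {η : ℝ} (hη : 0 < η)
    (hη1 : η ≤ 1) (hp : 1 - (p : ℝ) ≤ η) {j k : ℕ} (hj : j ≤ k) :
    (arrivalLaw p).real (⋃ s ∈ Finset.Icc (k - j) k,
      lossEvent (nonresonantTimes B (k - j) k s)) ≤
      (j + 1) * (η⁻¹ * (η ^ (1 - 1 / N : ℝ)) ^ j) := by
  refine (measureReal_biUnion_finset_le _ _).trans ?_
  have hcard : ((Finset.Icc (k - j) k).card : ℝ) = j + 1 := by
    rw [Nat.card_Icc]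
    have : k + 1 - (k - j) = j + 1 := by omega
    rw [this]
    push_cast
    rfl
  rw [← hcard, ← nsmul_eq_mul]
  refine Finset.sum_le_card_nsmul _ _ _ fun s hs => ?_
  rw [arrivalLaw_lossEvent]
  set T := nonresonantTimes B (k - j) k s
  have h1 : (j : ℝ) ≤ T.card + ((j / N : ℕ) + 1) := by
    exact_mod_cast le_card_nonresonantTimes hN hB hj (Finset.mem_Icc.1 hs).1
  have h2 : ((j / N : ℕ) : ℝ) ≤ j / N := Nat.cast_div_le
  calc (1 - (p : ℝ)) ^ T.card ≤ η ^ T.card :=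
        pow_le_pow_left₀ (sub_nonneg.2 p.2.2) hp _
    _ = η ^ (T.card : ℝ) := (Real.rpow_natCast _ _).symm
    _ ≤ η ^ (-1 + (1 - 1 / N) * j : ℝ) := by
        refine Real.rpow_le_rpow_of_exponent_ge hη hη1 ?_
        have : (1 - 1 / N : ℝ) * j = j - j / N := by ring
        linarith
    _ = η⁻¹ * (η ^ (1 - 1 / N : ℝ)) ^ j := by
        rw [Real.rpow_add hη, Real.rpow_neg_one, Real.rpow_mul hη.le, Real.rpow_natCast]

variable {m : ℕ} {C : Matrix (Fin m) (Fin 2) ℂ} {Q : Matrix (Fin 2) (Fin 2) ℂ}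
  {R : Matrix (Fin m) (Fin m) ℂ} {P₀ : Matrix (Fin 2) (Fin 2) ℂ} {l₁ l₂ : ℂ}

open scoped MatrixOrder Matrix.Norms.L2Operator in
/-- If the resonant gaps between measurements are at least `N` apart then the expected covariance
is bounded for losses of probability less than the critical value with the exponent `1 - 1 / N`. -/
lemma isLoewnerBounded_of_separated (hQ : Q.PosDef) (hR : R.PosDef) (hP₀ : P₀.PosSemidef)
    (hl₁ : 1 ≤ ‖l₁‖) (hl : ‖l₂‖ ≤ ‖l₁‖) {w : Fin m → ℂ} (hw₀ : (w ᵥ* C) 0 ≠ 0)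
    (hw₁ : (w ᵥ* C) 1 ≠ 0) {ε : ℝ} (hε : 0 < ε) {N : ℕ} (hN : 0 < N)
    (hsep : ∀ d d', ‖1 - (l₂ / l₁) ^ d‖ < ε → ‖1 - (l₂ / l₁) ^ d'‖ < ε → d < d' → d + N ≤ d')
    (p : unitInterval) {η : ℝ} (hη : 0 < η) (hη1 : η ≤ 1) (hp : 1 - (p : ℝ) ≤ η)
    (hηl : ‖l₁‖ ^ 2 * η ^ (1 - 1 / N : ℝ) < 1) :
    IsLoewnerBounded (expectedCov (diagonal ![l₁, l₂]) C Q R P₀ p) := by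
  classical
  set B : ℕ → Prop := fun d => ‖1 - (l₂ / l₁) ^ d‖ < ε
  obtain ⟨K, hK, hpair⟩ := exists_errorCov_le_of_pair (C := C) (P₀ := P₀) hQ hR hP₀ hl₁ hl hw₀ hw₁ hε
  obtain ⟨q, hq⟩ : ∃ z, z = ‖Q‖ := ⟨_, rfl⟩
  obtain ⟨c, hc⟩ : ∃ z, z = ‖P₀‖ := ⟨_, rfl⟩
  obtain ⟨α, hα⟩ : ∃ z, z = ‖l₁‖ := ⟨_, rfl⟩
  have hq0 : 0 ≤ q := hq ▸ norm_nonneg _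
  have hc0 : 0 ≤ c := hc ▸ norm_nonneg _
  have hA : ‖(diagonal ![l₁, l₂] : Matrix (Fin 2) (Fin 2) ℂ)‖ ≤ α :=
    hα ▸ norm_diagonal_two_le (norm_nonneg _) le_rfl hl
  rw [← hα] at hl₁ hηl hpair
  have hα2 : 1 ≤ α ^ 2 := one_le_pow₀ hl₁
  have hθ : 0 ≤ η ^ (1 - 1 / N : ℝ) := Real.rpow_nonneg hη.le _
  set θ := η ^ (1 - 1 / N : ℝ)
  -- Here `s` stands for the first arrival in the last `j` steps, and every later arrival there is
  -- at a resonant distance from it; `s = k` encodes a window without arrivals.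
  refine isLoewnerBounded_of_events hQ hR hP₀ p
    (fun k j => ⋃ s ∈ Finset.Icc (k - j) k, lossEvent (nonresonantTimes B (k - j) k s))
    (fun j => (α ^ 2) ^ (j + 1) * ((K + q + c) * (j + 1)))
    (fun j => (j + 1) * (η⁻¹ * θ ^ j)) (fun k j => ?_) (fun j => ?_)
    (fun k j hj => arrivalLaw_iUnion_lossEvent_le hN hsep p hη hη1 hp hj) (fun j => ?_) ?_
    fun k γ => ?_
  · exact Finset.measurableSet_biUnion _ fun s _ => (isClopen_lossEvent _).isOpen.measurableSet
  · have : 0 ≤ K + q + c := by linarith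
    exact mul_nonneg (by positivity) (mul_nonneg this (by positivity))
  · exact mul_nonneg (by positivity) (mul_nonneg (inv_nonneg.2 hη.le) (pow_nonneg hθ j))
  · have hx : ‖α ^ 2 * θ‖ < 1 := by
      rwa [Real.norm_of_nonneg (mul_nonneg (sq_nonneg _) hθ)]
    have h0 := summable_geometric_of_norm_lt_one hx
    have h1 := (summable_pow_mul_geometric_of_norm_lt_one 1 hx).mul_left 2
    have h2 := summable_pow_mul_geometric_of_norm_lt_one 2 hx
    refine (((h0.add h1).add h2).mul_left (α ^ 2 * (K + q + c) * η⁻¹)).congr fun j => ?_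
    rw [mul_pow]; ring
  · -- the shortest window which contains a pair of arrivals at a nonresonant distance
    set G : ℕ → Prop := fun j => ∃ s t, k - j ≤ s ∧ s < t ∧ t < k ∧ γ s = true ∧ γ t = true ∧
      ¬ B (t - s) with hG
    have hmem (j : ℕ) (hj : ¬ G j) :
        γ ∈ ⋃ s ∈ Finset.Icc (k - j) k, lossEvent (nonresonantTimes B (k - j) k s) := by
      simp only [Set.mem_iUnion, exists_prop]
      by_cases hex : ∃ s, k - j ≤ s ∧ s < k ∧ γ s = true
      · obtain ⟨h1, h2, h3⟩ := Nat.find_spec hex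
        refine ⟨Nat.find hex, Finset.mem_Icc.2 ⟨h1, h2.le⟩, fun i hi => ?_⟩
        simp only [nonresonantTimes, Finset.mem_filter, Finset.mem_Ico] at hi
        obtain ⟨⟨hi1, hi2⟩, hi3⟩ := hi
        by_contra hne
        have hγi : γ i = true := by simpa using hne
        have hle : Nat.find hex ≤ i := Nat.find_min' hex ⟨hi1, hi2, hγi⟩
        have hBi : ¬ B (i - Nat.find hex) := fun h => hi3 ⟨hle, h⟩
        -- Distance `0` is resonant, which exempts the first arrival itself from the required
        -- losses.
        have hlt : Nat.find hex < i := by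
          refine lt_of_le_of_ne hle fun h => hBi ?_
          have h0 : i - Nat.find hex = 0 := by omega
          rw [h0]
          simpa [B] using hε
        exact hj ⟨_, i, h1, hlt, hi2, h3, hγi, hBi⟩
      · push Not at hex
        refine ⟨k, Finset.mem_Icc.2 ⟨Nat.sub_le _ _, le_rfl⟩, fun i hi => ?_⟩
        simp only [nonresonantTimes, Finset.mem_filter, Finset.mem_Ico] at hi
        simpa using hex i hi.1.1 hi.1.2
    by_cases hGk : G k
    · have hex : ∃ j, G j := ⟨k, hGk⟩
      have hle : Nat.find hex ≤ k := Nat.find_min' hex hGk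
      have hspec := Nat.find_spec hex
      have hmin := fun j => Nat.find_min hex (m := j)
      set j₀ := Nat.find hex
      obtain ⟨s, t, hs, hst, htk, hγs, hγt, hB⟩ := hspec
      have hj₀ : 0 < j₀ := by omega
      -- By minimality the window of length `j₀ - 1` has no good pair, while the pair found starts
      -- at most `j₀` steps back; hence the exponent `j + 1` in the bound.
      refine ⟨j₀ - 1, by omega, hmem _ (hmin _ (by omega)), ?_⟩
      refine (hpair γ s t k hst htk hγs hγt (not_lt.1 hB)).trans (smul_one_le_smul_one ?_)
      have hn : k - s ≤ j₀ - 1 + 1 := by omega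
      have hn' : ((k - s : ℕ) : ℝ) ≤ (j₀ - 1 : ℕ) + 1 := by exact_mod_cast hn
      have hKc : K ≤ K + q + c := by linarith
      refine mul_le_mul (pow_le_pow_right₀ hα2 hn) (mul_le_mul hKc hn' (by positivity) (by linarith))
        (mul_nonneg hK (by positivity)) (by positivity)
    · refine ⟨k, le_rfl, hmem k hGk, ?_⟩
      have h := errorCov_add_le (C := C) (γ := γ) (k := 0) hQ hR hP₀ hl₁ hA (norm_nonneg P₀)
        hP₀.isHermitian.le_norm_smul_one k
      rw [zero_add, ← hc, ← hq] at h
      refine h.trans (smul_one_le_smul_one ?_)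
      have hk : (0 : ℝ) ≤ k := Nat.cast_nonneg k
      refine mul_le_mul (pow_le_pow_right₀ hα2 (Nat.le_succ k)) ?_ (by positivity) (by positivity)
      nlinarith [mul_nonneg hK hk, mul_nonneg hc0 hk]

lemma exists_pos_forall_lt_le (f : ℕ → ℝ) (N : ℕ) (hf : ∀ i < N, 0 < i → 0 < f i) :
    ∃ ε : ℝ, 0 < ε ∧ ∀ i < N, 0 < i → ε ≤ f i := by
  induction N with
  | zero => exact ⟨1, one_pos, by simp⟩
  | succ N ih =>
    obtain ⟨ε, hε, h⟩ := ih fun i hi => hf i (by omega)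
    rcases Nat.eq_zero_or_pos N with rfl | hN
    · exact ⟨1, one_pos, fun i hi hi' => by omega⟩
    · refine ⟨min ε (f N), lt_min hε (hf N (by omega) hN), fun i hi hi' => ?_⟩
      rcases Nat.lt_succ_iff_lt_or_eq.1 hi with h' | rfl
      · exact (min_le_left _ _).trans (h i h' hi')
      · exact min_le_right _ _

/-- Separation of the near returns to `1` of the powers of a point on the unit circle. -/
lemma exists_separated_of_norm_eq_one {z : ℂ} (hz : ‖z‖ = 1) {N : ℕ}
    (h : ∀ i < N, 0 < i → z ^ i ≠ 1) :
    ∃ ε : ℝ, 0 < ε ∧ ∀ d d', ‖1 - z ^ d‖ < ε → ‖1 - z ^ d'‖ < ε → d < d' → d + N ≤ d' := by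
  obtain ⟨ε, hε, hle⟩ := exists_pos_forall_lt_le (fun i => ‖1 - z ^ i‖) N
    fun i hi hi' => norm_pos_iff.2 (sub_ne_zero.2 (h i hi hi').symm)
  -- Two near returns within `ε / 2` make `z ^ (d' - d)` an `ε`-near return, because multiplying by
  -- `z ^ d` is an isometry.
  refine ⟨ε / 2, by positivity, fun d d' hd hd' hlt => ?_⟩
  by_contra hcon
  have h1 := hle (d' - d) (by omega) (by omega)
  have h2 : ‖1 - z ^ (d' - d)‖ = ‖z ^ d - z ^ d'‖ := by
    have : z ^ d - z ^ d' = z ^ d * (1 - z ^ (d' - d)) := by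
      rw [mul_sub, mul_one, ← pow_add, Nat.add_sub_cancel' hlt.le]
    rw [this, norm_mul, norm_pow, hz, one_pow, one_mul]
  have h3 : ‖z ^ d - z ^ d'‖ ≤ ‖1 - z ^ d'‖ + ‖1 - z ^ d‖ := by
    have : z ^ d - z ^ d' = (1 - z ^ d') - (1 - z ^ d) := by ring
    rw [this]
    exact norm_sub_le _ _
  linarith

/-- Positive powers of `z` stay at distance at least `1 - ‖z‖` from `1`. Only exponent `0` is
resonant, so the separation is vacuous for every `N`. -/
lemma separated_of_norm_lt_one {z : ℂ} (hz : ‖z‖ < 1) (N : ℕ) :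
    ∀ d d', ‖1 - z ^ d‖ < 1 - ‖z‖ → ‖1 - z ^ d'‖ < 1 - ‖z‖ → d < d' → d + N ≤ d' := by
  intro d d' _ hd' hlt
  exfalso
  have h1 : ‖z‖ ^ d' ≤ ‖z‖ := pow_le_of_le_one (norm_nonneg z) hz.le (by omega)
  have h2 : 1 - ‖z ^ d'‖ ≤ ‖1 - z ^ d'‖ := by
    simpa using norm_sub_norm_le (1 : ℂ) (z ^ d')
  rw [norm_pow] at h2
  linarith

end ResonantGaps

/-! ### Divergence along an eigenvector and along a periodic unobservable direction. -/

section UnboundedCases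

open scoped MatrixOrder

variable {m : ℕ} {C : Matrix (Fin m) (Fin 2) ℂ} {Q : Matrix (Fin 2) (Fin 2) ℂ}
  {R : Matrix (Fin m) (Fin m) ℂ} {P₀ : Matrix (Fin 2) (Fin 2) ℂ} {l₁ l₂ : ℂ}

lemma vecMulVec_smul_star {n : ℕ} (c : ℂ) (v : Fin n → ℂ) :
    vecMulVec (c • v) (star (c • v)) = ‖c‖ ^ 2 • vecMulVec v (star v) := by
  ext i j
  simp only [vecMulVec_apply, Pi.smul_apply, Pi.star_apply, smul_eq_mul, star_mul', Matrix.smul_apply,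
    RCLike.star_def, Complex.real_smul]
  push_cast
  rw [← Complex.mul_conj']
  ring

lemma not_isLoewnerBounded_of_one_le (hQ : Q.PosDef) (hR : R.PosDef) (hP₀ : P₀.PosSemidef)
    (p : unitInterval) (hp : 1 ≤ (1 - (p : ℝ)) * ‖l₁‖ ^ 2) :
    ¬ IsLoewnerBounded (expectedCov (diagonal ![l₁, l₂]) C Q R P₀ p) := by
  set v : Fin 2 → ℂ := ![1, 0] with hv
  obtain ⟨s, hs, hsQ⟩ := hQ.exists_smul_vecMulVec_le v
  have hAv : (diagonal ![l₁, l₂] : Matrix (Fin 2) (Fin 2) ℂ) *ᵥ v = l₁ • v := by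
    ext i
    fin_cases i <;> simp [hv, mulVec_diagonal]
  refine not_isLoewnerBounded_of_block_growth hQ hR hP₀ p (w := 1) {0} (by simp) v
    (fun h => one_ne_zero (congrFun h 0)) hs (sq_nonneg ‖l₁‖) (by simpa using hp)
    (fun γ i => hsQ.trans (by rw [mul_one]; exact le_errorCov_succ hQ hR hP₀)) ?_
  intro γ i a _ hγ h
  have hγ' : γ (i * 1) = false := by simpa using hγ 0
  have h1 := smul_vecMulVec_le_errorCov_succ_of_false hγ' h
  rw [hAv, vecMulVec_smul_star, smul_smul, mul_comm] at h1
  rw [add_smul, add_comm, add_mul, one_mul]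
  exact (add_le_add le_rfl hsQ).trans h1

/-- If an unobservable direction returns to itself after `q` steps, then arrivals at the multiples
of `q` do not help. -/
lemma not_isLoewnerBounded_of_resonance (hQ : Q.PosDef) (hR : R.PosDef) (hP₀ : P₀.PosSemidef)
    {v : Fin 2 → ℂ} (hv : v ≠ 0) (hCv : C *ᵥ v = 0) {q : ℕ} (hq : 2 ≤ q) (hl : l₁ ^ q = l₂ ^ q)
    (p : unitInterval) (hp : 1 ≤ (1 - (p : ℝ)) ^ (q - 1) * (‖l₁‖ ^ 2) ^ q) :
    ¬ IsLoewnerBounded (expectedCov (diagonal ![l₁, l₂]) C Q R P₀ p) := by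
  obtain ⟨s, hs, hsQ⟩ := hQ.exists_smul_vecMulVec_le v
  set A : Matrix (Fin 2) (Fin 2) ℂ := diagonal ![l₁, l₂] with hA
  have hAv : A ^ q *ᵥ v = l₁ ^ q • v := by
    rw [hA, diagonal_pow]
    ext i
    fin_cases i <;> simp [mulVec_diagonal, hl]
  have hwq (i : ℕ) : (i + 1) * q = (i * q + (q - 1)) + 1 := by
    rw [add_mul, one_mul]
    omega
  -- Offset `0` is left out: there the direction is `v` itself, invisible to `C`, so an arrival
  -- costs nothing.
  refine not_isLoewnerBounded_of_block_growth hQ hR hP₀ p (w := q) (Finset.Ico 1 q)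
    (fun i hi => (Finset.mem_Ico.1 hi).2) v hv hs (σ := (‖l₁‖ ^ 2) ^ q) (by positivity)
    (by simpa using hp)
    (fun γ i => hsQ.trans (by rw [hwq]; exact le_errorCov_succ hQ hR hP₀)) ?_
  intro γ i a _ hγ h
  have hQ0 : (0 : Matrix (Fin 2) (Fin 2) ℂ) ≤ Q := Matrix.nonneg_iff_posSemidef.2 hQ.posSemidef
  have hstep (j : ℕ) (hj : j + 1 < q) :
      a • vecMulVec (A ^ (j + 1) *ᵥ v) (star (A ^ (j + 1) *ᵥ v)) ≤
        errorCov A C Q R P₀ γ (i * q + (j + 1)) := by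
    induction j with
    | zero =>
      have h1 := smul_vecMulVec_le_errorCov_succ hQ hR hP₀ hCv h
      rw [zero_add, pow_one]
      exact (le_add_of_nonneg_right hQ0).trans h1
    | succ j ih =>
      have h1 := smul_vecMulVec_le_errorCov_succ_of_false
        (hγ (j + 1) (Finset.mem_Ico.2 ⟨by omega, by omega⟩)) (ih (by omega))
      rw [mulVec_mulVec, ← pow_succ'] at h1
      exact (le_add_of_nonneg_right hQ0).trans h1
  obtain ⟨j, rfl⟩ : ∃ j, q = j + 1 + 1 := ⟨q - 2, by omega⟩
  have h1 := smul_vecMulVec_le_errorCov_succ_of_false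
    (hγ (j + 1) (Finset.mem_Ico.2 ⟨by omega, by omega⟩)) (hstep j (by omega))
  rw [mulVec_mulVec, ← pow_succ', hAv, vecMulVec_smul_star, smul_smul, norm_pow, ← pow_mul,
    mul_comm (j + 1 + 1) 2, pow_mul, mul_comm a] at h1
  rw [add_smul, add_comm, hwq]
  exact (add_le_add le_rfl hsQ).trans h1

end UnboundedCases

/-! ### Detectability, rank of `C` and non-degeneracy. -/

section Observability

variable {m : ℕ} {C : Matrix (Fin m) (Fin 2) ℂ} {l₁ l₂ : ℂ}

lemma isSchurStable_diagonal_iff :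
    IsSchurStable (diagonal ![l₁, l₂]) ↔ ‖l₁‖ < 1 ∧ ‖l₂‖ < 1 := by
  simp [IsSchurStable, spectrum_diagonal, and_comm]

/-- An unobservable mode of a detectable system is stable. -/
lemma IsDetectable.norm_lt_one {n m : ℕ} {A : Matrix (Fin n) (Fin n) ℂ}
    {C : Matrix (Fin m) (Fin n) ℂ} (h : IsDetectable A C) {μ : ℂ} {x : Fin n → ℂ} (hx : x ≠ 0)
    (hA : A *ᵥ x = μ • x) (hC : C *ᵥ x = 0) : ‖μ‖ < 1 := by
  obtain ⟨L, hL⟩ := h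
  refine hL μ ?_
  rw [← Matrix.spectrum_toLin', ← Module.End.hasEigenvalue_iff_mem_spectrum]
  refine Module.End.hasEigenvalue_of_hasEigenvector (x := x)
    ⟨Module.End.mem_eigenspace_iff.2 ?_, hx⟩
  rw [toLin'_apply, sub_mulVec, ← mulVec_mulVec, hC, mulVec_zero, sub_zero, hA]

lemma IsDetectable.col_zero_ne_zero (h : IsDetectable (diagonal ![l₁, l₂]) C) (hl : 1 ≤ ‖l₁‖) :
    C.col 0 ≠ 0 := by
  intro h0
  refine absurd (h.norm_lt_one (μ := l₁) (x := Pi.single 0 1) (by simp) ?_ ?_) (not_lt.2 hl)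
  · ext i
    fin_cases i <;> simp
  · rw [mulVec_single_one, h0]

lemma IsDetectable.col_one_ne_zero (h : IsDetectable (diagonal ![l₁, l₂]) C) (hl : 1 ≤ ‖l₂‖) :
    C.col 1 ≠ 0 := by
  intro h0
  refine absurd (h.norm_lt_one (μ := l₂) (x := Pi.single 1 1) (by simp) ?_ ?_) (not_lt.2 hl)
  · ext i
    fin_cases i <;> simp
  · rw [mulVec_single_one, h0]

lemma exists_vecMul_apply_ne_zero {j : Fin 2} (h : C.col j ≠ 0) : ∃ w, (w ᵥ* C) j ≠ 0 := by
  obtain ⟨i, hi⟩ := Function.ne_iff.1 h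
  exact ⟨Pi.single i 1, by simpa using hi⟩

/-- Some combination of the outputs sees both modes. -/
lemma exists_vecMul_ne_zero (h₀ : C.col 0 ≠ 0) (h₁ : C.col 1 ≠ 0) :
    ∃ w, (w ᵥ* C) 0 ≠ 0 ∧ (w ᵥ* C) 1 ≠ 0 := by
  obtain ⟨u, hu⟩ := exists_vecMul_apply_ne_zero h₀
  obtain ⟨v, hv⟩ := exists_vecMul_apply_ne_zero h₁
  by_cases hu1 : (u ᵥ* C) 1 = 0
  · by_cases hv0 : (v ᵥ* C) 0 = 0
    · exact ⟨u + v, by simp [add_vecMul, hu, hv0], by simp [add_vecMul, hv, hu1]⟩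
    · exact ⟨v, hv0, hv⟩
  · exact ⟨u, hu, hu1⟩

lemma rank_eq_card_iff_linearIndependent_col {ι : Type*} [Fintype ι] (M : Matrix (Fin m) ι ℂ) :
    M.rank = Fintype.card ι ↔ LinearIndependent ℂ M.col := by
  rw [linearIndependent_iff_card_eq_finrank_span, rank_eq_finrank_span_cols, eq_comm]
  rfl

lemma exists_mulVec_eq_zero_of_rank_ne (h : C.rank ≠ 2) : ∃ x, x ≠ 0 ∧ C *ᵥ x = 0 := by
  by_contra! hcon
  refine h ?_
  have : Function.Injective C.mulVecLin := by
    rw [injective_iff_map_eq_zero]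
    exact fun x hx => by_contra fun hx0 => hcon x hx0 hx
  rw [Matrix.rank, LinearMap.finrank_range_of_inj this]
  simp

lemma exists_leftInverse_of_rank_eq (h : C.rank = 2) :
    ∃ L : Matrix (Fin 2) (Fin m) ℂ, L * C = 1 := by
  have hinj : Function.Injective C.mulVec := by
    rw [mulVec_injective_iff, ← rank_eq_card_iff_linearIndependent_col, h, Fintype.card_fin]
  obtain ⟨g, hg⟩ := LinearMap.exists_leftInverse_of_injective (toLin' C)
    (LinearMap.ker_eq_bot.2 hinj)
  refine ⟨LinearMap.toMatrix' g, ?_⟩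
  rw [← LinearMap.toMatrix'_toLin' C, ← LinearMap.toMatrix'_comp, hg, LinearMap.toMatrix'_id]

lemma not_isNondegenerate (h : ¬ (‖l₂‖ < ‖l₁‖ ∨ C.rank = 2)) (hl : ‖l₂‖ ≤ ‖l₁‖) :
    ¬ IsNondegenerate ![l₁, l₂] C := by
  intro hnd
  push Not at h
  have heq : ‖l₁‖ = ‖l₂‖ := le_antisymm h.1 hl
  have h1 := hnd Finset.univ fun i _ j _ => by
    fin_cases i <;> fin_cases j <;> simp [heq]
  rw [← Fintype.card_coe, rank_eq_card_iff_linearIndependent_col] at h1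
  refine h.2 ?_
  have h2 := h1.comp (fun i : Fin 2 => (⟨i, Finset.mem_univ i⟩ : (Finset.univ : Finset (Fin 2))))
    fun i j hij => congrArg Subtype.val hij
  have h3 := (rank_eq_card_iff_linearIndependent_col C).2 h2
  rwa [Fintype.card_fin] at h3

lemma isNondegenerate_of_detectable (hdet : IsDetectable (diagonal ![l₁, l₂]) C)
    (hl : ‖l₂‖ ≤ ‖l₁‖) (hl₂ : 1 ≤ ‖l₂‖) (h : ‖l₂‖ < ‖l₁‖ ∨ C.rank = 2) :
    IsNondegenerate ![l₁, l₂] C := by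
  intro I hI
  rw [← Fintype.card_coe, rank_eq_card_iff_linearIndependent_col]
  rcases h with h | h
  -- With distinct moduli an equi-block has at most one index, so only nonzero columns are needed;
  -- detectability supplies these for unstable modes.
  · have hsub : Subsingleton I := by
      refine ⟨fun ⟨i, hi⟩ ⟨j, hj⟩ => Subtype.ext ?_⟩
      have := hI i hi j hj
      revert this
      fin_cases i <;> fin_cases j <;> simp [h.ne, h.ne']
    rw [linearIndependent_subsingleton_index_iff]
    rintro ⟨i, hi⟩
    change C.col i ≠ 0
    fin_cases i
    · exact hdet.col_zero_ne_zero (hl₂.trans hl)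
    · exact hdet.col_one_ne_zero hl₂
  · have h1 := (rank_eq_card_iff_linearIndependent_col C).1 (by rw [h, Fintype.card_fin])
    exact h1.comp (fun i : I => (i : Fin 2)) Subtype.val_injective

end Observability

/-! ### Arithmetic of the rotation angle and of the threshold exponents. -/

section Thresholds

lemma modifiedDirichlet_ratCast (r : ℚ) : modifiedDirichlet r = 1 / (r.den : ℝ) := by
  have h : ∃ s : ℚ, (s : ℝ) = (r : ℝ) := ⟨r, rfl⟩
  rw [modifiedDirichlet, dif_pos h, Rat.cast_injective h.choose_spec]

lemma modifiedDirichlet_of_irrational {x : ℝ} (hx : ¬ ∃ r : ℚ, (r : ℝ) = x) :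
    modifiedDirichlet x = 0 := by
  rw [modifiedDirichlet, dif_neg hx]

lemma exp_pow_eq_one_iff (φ : ℝ) (i : ℕ) :
    Complex.exp (φ * Complex.I) ^ i = 1 ↔ ∃ n : ℤ, (i : ℝ) * (φ / (2 * Real.pi)) = n := by
  rw [← Complex.exp_nat_mul, Complex.exp_eq_one_iff]
  refine exists_congr fun n => ?_
  have hpi : (2 * Real.pi : ℝ) ≠ 0 := by positivity
  rw [← mul_div_assoc, div_eq_iff hpi]
  constructor
  · intro h
    have h1 : ((i * φ : ℝ) : ℂ) = ((n * (2 * Real.pi) : ℝ) : ℂ) := by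
      refine mul_right_cancel₀ Complex.I_ne_zero ?_
      push_cast
      linear_combination h
    exact_mod_cast h1
  · intro h
    have h1 : ((i * φ : ℝ) : ℂ) = ((n * (2 * Real.pi) : ℝ) : ℂ) := by rw [h]
    push_cast at h1
    linear_combination Complex.I * h1

/-- The strict threshold leaves room for a positive rate even when `y = 0`, that is, at `p = 1`;
half the threshold serves as a floor. -/
lemma exists_rate {α e y : ℝ} (hα : 1 ≤ α) (he : 0 < e) (hy : y < α ^ (-(2 / e))) :
    ∃ η : ℝ, 0 < η ∧ η ≤ 1 ∧ y ≤ η ∧ α ^ 2 * η ^ e < 1 := by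
  have hα0 : 0 < α := by linarith
  have hX0 : 0 < α ^ (-(2 / e)) := Real.rpow_pos_of_pos hα0 _
  have hX1 : α ^ (-(2 / e)) ≤ 1 :=
    Real.rpow_le_one_of_one_le_of_nonpos hα (neg_nonpos.2 (by positivity))
  have hXe : (α ^ (-(2 / e))) ^ e = (α ^ 2)⁻¹ := by
    rw [← Real.rpow_mul hα0.le, neg_mul, div_mul_cancel₀ _ he.ne', Real.rpow_neg hα0.le]
    norm_num
  set X := α ^ (-(2 / e))
  have hη : max y (X / 2) < X := max_lt hy (by linarith)
  have hη0 : 0 < max y (X / 2) := lt_max_of_lt_right (by linarith)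
  refine ⟨max y (X / 2), hη0, hη.le.trans hX1, le_max_left _ _, ?_⟩
  have h1 := Real.rpow_lt_rpow hη0.le hη he
  rw [hXe] at h1
  calc α ^ 2 * max y (X / 2) ^ e < α ^ 2 * (α ^ 2)⁻¹ := by gcongr
    _ = 1 := mul_inv_cancel₀ (by positivity)

/-- The exponent tends to `-2` as `N` grows, so a strict inequality at the limit already holds for
some finite `N`. -/
lemma exists_nat_lt_rpow {α y : ℝ} (hα : 1 ≤ α) (hy : y < α ^ (-2 : ℝ)) :
    ∃ N : ℕ, 2 ≤ N ∧ y < α ^ (-(2 / (1 - 1 / N : ℝ))) := by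
  have h1 : Filter.Tendsto (fun N : ℕ => α ^ (-(2 / (1 - 1 / N : ℝ)))) Filter.atTop
      (nhds (α ^ (-(2 / (1 - 0 : ℝ))))) := by
    refine Filter.Tendsto.rpow tendsto_const_nhds ?_ (Or.inl (by linarith))
    exact (Filter.Tendsto.div tendsto_const_nhds
      (tendsto_const_nhds.sub tendsto_one_div_atTop_nhds_zero_nat) (by norm_num)).neg
  have h2 : y < α ^ (-(2 / (1 - 0 : ℝ))) := by
    rwa [sub_zero, div_one]
  obtain ⟨N, hN, hN'⟩ := ((h1.eventually (lt_mem_nhds h2)).and (Filter.eventually_ge_atTop 2)).exists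
  exact ⟨N, hN', hN⟩

end Thresholds

/-! ### Assembly of the critical values. -/

section CriticalValues

variable {m : ℕ} {C : Matrix (Fin m) (Fin 2) ℂ} {Q : Matrix (Fin 2) (Fin 2) ℂ}
  {R : Matrix (Fin m) (Fin m) ℂ} {P₀ : Matrix (Fin 2) (Fin 2) ℂ} {l₁ l₂ : ℂ}

lemma lt_rpow_neg_two_iff {α y : ℝ} (hα : 0 < α) : y < α ^ (-2 : ℝ) ↔ α ^ 2 * y < 1 := by
  rw [Real.rpow_neg hα.le, Real.rpow_two, ← one_div, lt_div_iff₀ (by positivity),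
    mul_comm]

open scoped Matrix.Norms.L2Operator in
lemma isLoewnerBounded_of_isSchurStable (hQ : Q.PosDef) (hR : R.PosDef) (hP₀ : P₀.PosSemidef)
    (h : ‖l₁‖ < 1) (hl : ‖l₂‖ ≤ ‖l₁‖) (p : unitInterval) :
    IsLoewnerBounded (expectedCov (diagonal ![l₁, l₂]) C Q R P₀ p) :=
  isLoewnerBounded_of_norm_lt_one hQ hR hP₀
    ((norm_diagonal_two_le (norm_nonneg _) le_rfl hl).trans_lt h) p

lemma isLoewnerBounded_of_separated_of_lt (hQ : Q.PosDef) (hR : R.PosDef) (hP₀ : P₀.PosSemidef)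
    (hl₁ : 1 ≤ ‖l₁‖) (hl : ‖l₂‖ ≤ ‖l₁‖) (h₀ : C.col 0 ≠ 0) (h₁ : C.col 1 ≠ 0) {N : ℕ} (hN : 2 ≤ N)
    (hsep : ∃ ε : ℝ, 0 < ε ∧ ∀ d d', ‖1 - (l₂ / l₁) ^ d‖ < ε → ‖1 - (l₂ / l₁) ^ d'‖ < ε →
      d < d' → d + N ≤ d')
    (p : unitInterval) (hp : 1 - (p : ℝ) < ‖l₁‖ ^ (-(2 / (1 - 1 / N : ℝ)))) :
    IsLoewnerBounded (expectedCov (diagonal ![l₁, l₂]) C Q R P₀ p) := by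
  obtain ⟨ε, hε, hsep⟩ := hsep
  obtain ⟨w, hw₀, hw₁⟩ := exists_vecMul_ne_zero h₀ h₁
  have he : (0 : ℝ) < 1 - 1 / N := by
    have : (2 : ℝ) ≤ N := by exact_mod_cast hN
    rw [sub_pos, div_lt_one (by linarith)]
    linarith
  obtain ⟨η, hη, hη1, hpη, hηl⟩ := exists_rate hl₁ he hp
  exact isLoewnerBounded_of_separated hQ hR hP₀ hl₁ hl hw₀ hw₁ hε (by omega) hsep p hη hη1 hpη hηl

open scoped Matrix.Norms.L2Operator in
lemma isLoewnerBounded_of_distinct_moduli_or_rank (hQ : Q.PosDef) (hR : R.PosDef)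
    (hP₀ : P₀.PosSemidef) (hdet : IsDetectable (diagonal ![l₁, l₂]) C)
    (h : ‖l₂‖ < ‖l₁‖ ∨ C.rank = 2) (hl₁ : 1 ≤ ‖l₁‖) (hl : ‖l₂‖ ≤ ‖l₁‖) (p : unitInterval)
    (hp : 1 - (p : ℝ) < ‖l₁‖ ^ (-2 : ℝ)) :
    IsLoewnerBounded (expectedCov (diagonal ![l₁, l₂]) C Q R P₀ p) := by
  have hp' := (lt_rpow_neg_two_iff (by linarith)).1 hp
  have hA : ‖(diagonal ![l₁, l₂] : Matrix (Fin 2) (Fin 2) ℂ)‖ ≤ ‖l₁‖ :=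
    norm_diagonal_two_le (norm_nonneg _) le_rfl hl
  by_cases hrank : C.rank = 2
  · obtain ⟨L, hL⟩ := exists_leftInverse_of_rank_eq hrank
    exact isLoewnerBounded_of_reset hQ hR hP₀ (E := 0) (by simp) (by simp) (by simp) (L := L)
      (by simp [hL]) hl₁ hA p hp'
  have hlt := h.resolve_right hrank
  have h₀ := hdet.col_zero_ne_zero hl₁
  rcases lt_or_ge ‖l₂‖ 1 with hl₂ | hl₂
  · obtain ⟨w, hw⟩ := exists_vecMul_apply_ne_zero h₀
    -- `E` projects onto the stable second mode. The gain reads off the first mode, so the first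
    -- column of `1 - L * C` vanishes.
    refine isLoewnerBounded_of_reset hQ hR hP₀ (E := diagonal ![0, 1])
      (L := vecMulVec ![((w ᵥ* C) 0)⁻¹, 0] w) ?_ ?_ ?_ ?_ hl₁ hA p hp'
    · simp [diagonal_mul_diagonal, mul_comm]
    · rw [diagonal_mul_diagonal]
      congr 1
      ext i
      fin_cases i <;> simp
    · rw [diagonal_mul_diagonal]
      refine lt_of_le_of_lt (le_trans (le_of_eq ?_)
        (norm_diagonal_two_le (a := 0) (norm_nonneg l₂) (by simp) le_rfl)) hl₂
      congr 2
      ext i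
      fin_cases i <;> simp
    · rw [vecMulVec_mul]
      ext i j
      rw [mul_diagonal, Matrix.sub_apply, vecMulVec_apply]
      fin_cases i <;> fin_cases j <;> simp [hw]
  -- Both modes are unstable but of distinct moduli: no positive distance is resonant, so `N` may be
  -- as large as `p` requires.
  · obtain ⟨N, hN, hpN⟩ := exists_nat_lt_rpow hl₁ hp
    refine isLoewnerBounded_of_separated_of_lt hQ hR hP₀ hl₁ hl h₀ (hdet.col_one_ne_zero hl₂) hN
      ⟨1 - ‖l₂ / l₁‖, ?_, separated_of_norm_lt_one ?_ N⟩ p hpN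
    · rw [norm_div, sub_pos, div_lt_one (by linarith)]
      exact hlt
    · rw [norm_div, div_lt_one (by linarith)]
      exact hlt

/-- Assembly of a critical value from its two regimes. -/
lemma isCriticalValue_max (hQ : Q.PosDef) (hR : R.PosDef) (hP₀ : P₀.PosSemidef)
    (hl : ‖l₂‖ ≤ ‖l₁‖) {X : ℝ} (hX : 0 < X) (hX1 : ‖l₁‖ < 1 → 1 ≤ X)
    (hunb : 1 ≤ ‖l₁‖ → ∀ p : unitInterval, X ≤ 1 - (p : ℝ) →
      ¬ IsLoewnerBounded (expectedCov (diagonal ![l₁, l₂]) C Q R P₀ p))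
    (hbdd : 1 ≤ ‖l₁‖ → ∀ p : unitInterval, 1 - (p : ℝ) < X →
      ∀ P₁ : Matrix (Fin 2) (Fin 2) ℂ, P₁.PosSemidef →
        IsLoewnerBounded (expectedCov (diagonal ![l₁, l₂]) C Q R P₁ p)) :
    IsCriticalValue (diagonal ![l₁, l₂]) C Q R P₀ (max (1 - X) 0) where
  nonneg := le_max_right _ _
  lt_one := max_lt (by linarith) one_pos
  unbounded p hp hp0 := by
    -- At `p = 0` the `max` carries no information on `X`; instability of `A` gives divergence
    -- directly.
    rcases p.2.1.eq_or_lt with h0 | h0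
    · have h1 : 1 ≤ ‖l₁‖ := by
        by_contra! h1
        exact hp0 h0.symm (isSchurStable_diagonal_iff.2 ⟨h1, hl.trans_lt h1⟩)
      refine not_isLoewnerBounded_of_one_le hQ hR hP₀ p ?_
      rw [← h0, sub_zero, one_mul]
      exact one_le_pow₀ h1
    · have h1 : (p : ℝ) ≤ 1 - X := (le_max_iff.1 hp).resolve_right (not_le.2 h0)
      have h2 : 1 ≤ ‖l₁‖ := by
        by_contra! h2
        linarith [hX1 h2]
      exact hunb h2 p (by linarith)
  bounded p hp P₁ hP₁ := by
    rcases lt_or_ge ‖l₁‖ 1 with h1 | h1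
    · exact isLoewnerBounded_of_isSchurStable hQ hR hP₁ h1 hl p
    · exact hbdd h1 p (by linarith [le_max_left (1 - X) 0]) P₁ hP₁

lemma not_isLoewnerBounded_of_rpow_le (hQ : Q.PosDef) (hR : R.PosDef) (hP₀ : P₀.PosSemidef)
    (hl₁ : 1 ≤ ‖l₁‖) (p : unitInterval) (hp : ‖l₁‖ ^ (-2 : ℝ) ≤ 1 - (p : ℝ)) :
    ¬ IsLoewnerBounded (expectedCov (diagonal ![l₁, l₂]) C Q R P₀ p) := by
  refine not_isLoewnerBounded_of_one_le hQ hR hP₀ p ?_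
  have := (lt_rpow_neg_two_iff (y := 1 - (p : ℝ)) (by linarith : 0 < ‖l₁‖)).not.1 (not_lt.2 hp)
  linarith

lemma isCriticalValue_of_distinct_moduli_or_rank (hQ : Q.PosDef) (hR : R.PosDef)
    (hP₀ : P₀.PosSemidef) (hdet : IsDetectable (diagonal ![l₁, l₂]) C) (hl : ‖l₂‖ ≤ ‖l₁‖)
    (h : ‖l₂‖ < ‖l₁‖ ∨ C.rank = 2) (hl₁ : l₁ ≠ 0) :
    IsCriticalValue (diagonal ![l₁, l₂]) C Q R P₀ (max (1 - ‖l₁‖ ^ (-2 : ℝ)) 0) :=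
  isCriticalValue_max hQ hR hP₀ hl (Real.rpow_pos_of_pos (norm_pos_iff.2 hl₁) _)
    (fun h1 => Real.one_le_rpow_of_pos_of_le_one_of_nonpos (norm_pos_iff.2 hl₁) h1.le (by norm_num))
    (fun h1 p hp => not_isLoewnerBounded_of_rpow_le hQ hR hP₀ h1 p hp)
    fun h1 p hp _ hP₁ => isLoewnerBounded_of_distinct_moduli_or_rank hQ hR hP₁ hdet h h1 hl p hp

lemma isCriticalValue_of_resonance (hQ : Q.PosDef) (hR : R.PosDef) (hP₀ : P₀.PosSemidef)
    (hdet : IsDetectable (diagonal ![l₁, l₂]) C) (h : ¬ (‖l₂‖ < ‖l₁‖ ∨ C.rank = 2))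
    (hne : l₁ ≠ l₂) {φ : ℝ} (hφ : l₁ = l₂ * Complex.exp (φ * Complex.I)) :
    IsCriticalValue (diagonal ![l₁, l₂]) C Q R P₀
      (max (1 - ‖l₁‖ ^ (-(2 / (1 - modifiedDirichlet (φ / (2 * Real.pi)))))) 0) := by
  push Not at h
  obtain ⟨v, hv, hCv⟩ := exists_mulVec_eq_zero_of_rank_ne h.2
  have hnorm : ‖l₁‖ = ‖l₂‖ := by
    rw [hφ, norm_mul, Complex.norm_exp_ofReal_mul_I, mul_one]
  have hl₂0 : l₂ ≠ 0 := by
    rintro rfl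
    simp [hφ] at hne
  have hpos : 0 < ‖l₁‖ := by rw [hnorm]; exact norm_pos_iff.2 hl₂0
  have hz1 : ‖l₂ / l₁‖ = 1 := by rw [norm_div, hnorm, div_self (norm_ne_zero_iff.2 hl₂0)]
  have hzpow (i : ℕ) : (l₂ / l₁) ^ i = 1 ↔ ∃ n : ℤ, (i : ℝ) * (φ / (2 * Real.pi)) = n := by
    rw [← exp_pow_eq_one_iff, hφ, div_mul_cancel_left₀ hl₂0, inv_pow, inv_eq_one]
  have hcols (h1 : 1 ≤ ‖l₁‖) : C.col 0 ≠ 0 ∧ C.col 1 ≠ 0 :=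
    ⟨hdet.col_zero_ne_zero h1, hdet.col_one_ne_zero (hnorm ▸ h1)⟩
  by_cases hrat : ∃ r : ℚ, (r : ℝ) = φ / (2 * Real.pi)
  · obtain ⟨r, hr⟩ := hrat
    rw [← hr, modifiedDirichlet_ratCast]
    set q := r.den
    have hqr : ((q : ℕ) : ℝ) * (r : ℝ) = r.num := by
      exact_mod_cast Rat.den_mul_eq_num r
    -- Denominator `1` would mean `l₁ = l₂`.
    have hq : 2 ≤ q := by
      have h0 : 0 < q := r.den_pos
      have h1 : q ≠ 1 := by
        intro h1
        have := (hzpow 1).2 ⟨r.num, by rw [← hr, ← hqr, h1]⟩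
        rw [pow_one, div_eq_one_iff_eq (norm_pos_iff.1 hpos)] at this
        exact hne this.symm
      omega
    have hlq : l₁ ^ q = l₂ ^ q := by
      have := (hzpow q).2 ⟨r.num, by rw [← hr, hqr]⟩
      rw [div_pow, div_eq_one_iff_eq (pow_ne_zero _ (norm_pos_iff.1 hpos))] at this
      exact this.symm
    have hprim (i : ℕ) (hi : i < q) (hi0 : 0 < i) : (l₂ / l₁) ^ i ≠ 1 := by
      rw [Ne, hzpow, ← hr]
      rintro ⟨n, hn⟩
      have h1 : (i : ℚ) * r = n := by exact_mod_cast hn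
      have h2 : (i : ℤ) * r.num = n * q := by
        have h3 : (r.num : ℚ) = q * r := (Rat.den_mul_eq_num r).symm
        have h4 : ((i * r.num : ℤ) : ℚ) = (n * q : ℤ) := by
          push_cast
          rw [h3, ← h1]
          ring
        exact_mod_cast h4
      have h3 : (q : ℤ) ∣ i * r.num := ⟨n, by rw [h2, mul_comm]⟩
      have h4 : (q : ℤ) ∣ i :=
        IsCoprime.dvd_of_dvd_mul_right (Rat.isCoprime_num_den r).symm h3
      exact absurd (Nat.le_of_dvd hi0 (Int.natCast_dvd_natCast.1 h4)) (not_le.2 hi)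
    have hq' : (2 : ℝ) ≤ q := by exact_mod_cast hq
    have he : (0 : ℝ) < 1 - 1 / q := by
      rw [sub_pos, div_lt_one (by linarith)]
      linarith
    refine isCriticalValue_max hQ hR hP₀ hnorm.ge (Real.rpow_pos_of_pos hpos _)
      (fun h1 => Real.one_le_rpow_of_pos_of_le_one_of_nonpos hpos h1.le
        (neg_nonpos.2 (by positivity))) (fun h1 p hp => ?_) fun h1 p hp P₁ hP₁ =>
        isLoewnerBounded_of_separated_of_lt hQ hR hP₁ h1 hnorm.ge (hcols h1).1 (hcols h1).2 hq
          (exists_separated_of_norm_eq_one hz1 hprim) p hp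
    refine not_isLoewnerBounded_of_resonance hQ hR hP₀ hv hCv hq hlq p ?_
    have h2 := pow_le_pow_left₀ (Real.rpow_nonneg hpos.le _) hp (q - 1)
    -- The exponent is `-2 * q / (q - 1)`: at the threshold, `q - 1` losses exactly balance the
    -- growth over one period.
    have h3 : (‖l₁‖ ^ (-(2 / (1 - 1 / q : ℝ)))) ^ (q - 1) = ((‖l₁‖ ^ 2) ^ q)⁻¹ := by
      rw [← Real.rpow_natCast, ← Real.rpow_mul hpos.le, Nat.cast_sub (by omega), Nat.cast_one,
        ← pow_mul, ← Real.rpow_natCast, ← Real.rpow_neg hpos.le]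
      congr 1
      have hq0 : (q : ℝ) ≠ 0 := by linarith
      have hq1 : (q : ℝ) - 1 ≠ 0 := by linarith
      push_cast
      field_simp
    rw [h3] at h2
    calc 1 = ((‖l₁‖ ^ 2) ^ q)⁻¹ * (‖l₁‖ ^ 2) ^ q := (inv_mul_cancel₀ (by positivity)).symm
      _ ≤ _ := by gcongr
  · rw [modifiedDirichlet_of_irrational hrat, sub_zero, div_one]
    refine isCriticalValue_max hQ hR hP₀ hnorm.ge (Real.rpow_pos_of_pos hpos _)
      (fun h1 => Real.one_le_rpow_of_pos_of_le_one_of_nonpos hpos h1.le (by norm_num))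
      (fun h1 p hp => not_isLoewnerBounded_of_rpow_le hQ hR hP₀ h1 p hp) fun h1 p hp P₁ hP₁ => ?_
    -- For an irrational angle no positive power of `l₂ / l₁` is `1`, so near returns can be made
    -- `N` apart for any `N`.
    obtain ⟨N, hN, hpN⟩ := exists_nat_lt_rpow h1 hp
    refine isLoewnerBounded_of_separated_of_lt hQ hR hP₁ h1 hnorm.ge (hcols h1).1 (hcols h1).2 hN
      (exists_separated_of_norm_eq_one hz1 fun i _ hi0 hi => hrat ?_) p hpN
    obtain ⟨n, hn⟩ := (hzpow i).1 hi
    have hi' : (i : ℝ) ≠ 0 := by positivity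
    refine ⟨n / i, ?_⟩
    push_cast
    rw [← hn, mul_div_cancel_left₀ _ hi']

lemma isCriticalValue_zero (hQ : Q.PosDef) (hR : R.PosDef) (hl : ‖l₂‖ ≤ ‖l₁‖) (h1 : ‖l₁‖ < 1) :
    IsCriticalValue (diagonal ![l₁, l₂]) C Q R P₀ 0 where
  nonneg := le_rfl
  lt_one := one_pos
  unbounded p hp hp0 := absurd (isSchurStable_diagonal_iff.2 ⟨h1, hl.trans_lt h1⟩)
    (hp0 (le_antisymm hp p.2.1))
  bounded p _ _ hP₁ := isLoewnerBounded_of_isSchurStable hQ hR hP₁ h1 hl p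

/-- The state matrix is scalar, so a null vector of `C` is an unobservable eigenvector. -/
lemma norm_lt_one_of_eq_of_rank_ne (hdet : IsDetectable (diagonal ![l₁, l₂]) C)
    (h : C.rank ≠ 2) (heq : l₁ = l₂) : ‖l₁‖ < 1 := by
  obtain ⟨x, hx, hCx⟩ := exists_mulVec_eq_zero_of_rank_ne h
  refine hdet.norm_lt_one hx ?_ hCx
  ext i
  fin_cases i <;> simp [mulVec_diagonal, heq]

end CriticalValues

theorem theorem5 {m : ℕ} (l₁ l₂ : ℂ) (C : Matrix (Fin m) (Fin 2) ℂ)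
    (Q S₀ : Matrix (Fin 2) (Fin 2) ℂ) (R : Matrix (Fin m) (Fin m) ℂ)
    (hl : ‖l₂‖ ≤ ‖l₁‖) (hdet : IsDetectable (Matrix.diagonal ![l₁, l₂]) C)
    (hQ : Q.PosDef) (hS₀ : S₀.PosDef) (hR : R.PosDef) :
    -- first formula
    ((‖l₂‖ < ‖l₁‖ ∨ C.rank = 2) → l₁ ≠ 0 →
      IsCriticalValue (Matrix.diagonal ![l₁, l₂]) C Q R S₀ (max (1 - ‖l₁‖ ^ (-2 : ℝ)) 0)) ∧
    -- second formula
    (¬ (‖l₂‖ < ‖l₁‖ ∨ C.rank = 2) → l₁ ≠ l₂ → ∀ φ : ℝ, l₁ = l₂ * Complex.exp (φ * Complex.I) →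
      IsCriticalValue (Matrix.diagonal ![l₁, l₂]) C Q R S₀
        (max (1 - ‖l₁‖ ^ (-(2 / (1 - modifiedDirichlet (φ / (2 * Real.pi)))))) 0)) ∧
    -- the cases where the formulas read `max (1 - ∞) 0`: a zero base, or a zero denominator
    (l₁ = 0 ∨ (¬ (‖l₂‖ < ‖l₁‖ ∨ C.rank = 2) ∧ l₁ = l₂) →
      IsCriticalValue (Matrix.diagonal ![l₁, l₂]) C Q R S₀ 0) ∧
    -- the case distinction is the one between non-degenerate and degenerate systems
    (¬ (‖l₂‖ < ‖l₁‖ ∨ C.rank = 2) → ¬ IsNondegenerate ![l₁, l₂] C) ∧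
    (1 ≤ ‖l₂‖ → (IsNondegenerate ![l₁, l₂] C ↔ (‖l₂‖ < ‖l₁‖ ∨ C.rank = 2))) := by
  refine ⟨fun h hl₁ => isCriticalValue_of_distinct_moduli_or_rank hQ hR hS₀.posSemidef hdet hl h hl₁,
    fun h hne φ hφ => isCriticalValue_of_resonance hQ hR hS₀.posSemidef hdet h hne hφ,
    fun h => isCriticalValue_zero hQ hR hl ?_, fun h => not_isNondegenerate h hl,
    fun hl₂ => ⟨fun h => by_contra fun hcon => not_isNondegenerate hcon hl h,
      isNondegenerate_of_detectable hdet hl hl₂⟩⟩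
  rcases h with h | ⟨h, heq⟩
  · simp [h]
  · exact norm_lt_one_of_eq_of_rank_ne hdet (fun hr => h (Or.inr hr)) heq
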